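/- For $d\in\{2,3\}$ let $\operatorname{Arm}_d(n)$ be the space of lists of edge vectors $(e_1,\dots,e_n)$ in $\mathbb{R}^d$ with $\sum_k|e_k|=2$, and $\operatorname{Pol}_d(n)\subset\operatorname{Arm}_d(n)$ the subspace of closed polygons ($\sum_k e_k=0$). Let $\operatorname{Hopf}(q)=\bar q\,\mathbf{i}\,q$, applied coordinatewise, map $\mathbb{H}^n$ to lists of $n$ vectors in $\mathbb{R}^3=\operatorname{Im}\mathbb{H}$, and identify $\mathbb{R}^2$ with the plane $\mathbf{i}\oplus\mathbf{k}$, so that $\operatorname{Arm}_2(n)\subset\operatorname{Arm}_3(n)$. Identify $\mathbb{C}^n\times\mathbb{C}^n$ with $\mathbb{H}^n$ by $(u,v)\mapsto u+v\mathbf{j}$. The symmetric measure of a measurable subset $U$ of one of these spaces is $\mu(U)=\operatorname{Vol}(M\cap\operatorname{Hopf}^{-1}(U))/\operatorname{Vol}(M)$, where $\operatorname{Vol}$ is the Riemannian volume of the metric induced from $\mathbb{H}^n=\mathbb{R}^{4n}$ on the submanifold $M$, and - for $\operatorname{Arm}_3(n)$, $M=S^{4n-1}$ is the sphere of radius $\sqrt2$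 in $\mathbb{H}^n$; - for $\operatorname{Arm}_2(n)$, $M=S^{2n-1}\sqcup S^{2n-1}$ is the union of the spheres of radius $\sqrt2$ in $(1\oplus\mathbf{j})^n$ and in $(\mathbf{i}\oplus\mathbf{k})^n$; - for $\operatorname{Pol}_3(n)$, $M=V_2(\mathbb{C}^n)$ is the Stiefel manifold of Hermitian orthonormal $2$-frames; - for $\operatorname{Pol}_2(n)$, $M=V_2(\mathbb{R}^n)\sqcup\mathbf{i}V_2(\mathbb{R}^n)$. Let $1\le i\le n$. Under the symmetric measures, the length $|e_i|$ of the $i$th edge has the following probability density functions, with no mass outside the stated interval. 1. For spatial and planar arms with $n\ge2$ edges, on $[0,2]$, $$\phi_3^{\mathrm{Arm}}(y)=\frac{(2n-2)(2n-1)}{2^{2n-1}}\,y(2-y)^{2n-3},\qquad \phi_2^{\mathrm{Arm}}(y)=\frac{n-1}{2^{n-1}}(2-y)^{n-2}.$$ 2. For closed spatial and planar polygons with $n\ge3$ edges, on $[0,1]$, $$\phi_3^{\mathrm{Pol}}(y)=(n-2)(n-1)\,y(1-y)^{n-3},\qquad \phi_2^{\mathrm{Pol}}(y)=\left(\frac n2-1\right)(1-y)^{\frac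 n2-2}.$$ In particular $|e_i|$ is beta distributed: on $[0,2]$ with shape parameters $(2,2n-2)$ for spatial arms and $(1,n-1)$ for planar arms, and on $[0,1]$ with shape parameters $(2,n-2)$ for closed spatial polygons and $(1,\frac n2-1)$ for closed planar polygons. -/

import Mathlib

open MeasureTheory ProbabilityTheory
open scoped Quaternion ENNReal

noncomputable section

namespace RandomPolygon

/-! ### Spaces of arms and closed polygons -/

/-- Euclidean space of dimension `d`. -/
abbrev Vec (d : ℕ) : Type := EuclideanSpace ℝ (Fin d)

/-- The space of `n`-edge polygonal arms of total length `2` in `ℝ^d`, up to translation: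
lists of edge vectors whose lengths sum to `2`. -/
def Arm (d n : ℕ) : Set (Fin n → Vec d) :=
  {e | ∑ i, ‖e i‖ = 2}

/-- The space of closed `n`-edge polygons of total length `2` in `ℝ^d`, up to translation. -/
def Pol (d n : ℕ) : Set (Fin n → Vec d) :=
  {e | ∑ i, ‖e i‖ = 2 ∧ ∑ i, e i = 0}

/-- The inclusion of the plane in space as the span of the first and the third basis vector, that
is, as the plane `𝐢 ⊕ 𝐤` of imaginary quaternions, applied to every edge of an edge list. -/
def planeToSpace {n : ℕ} (e : Fin n → Vec 2) : Fin n → Vec 3 :=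
  fun k => !₂[e k 0, 0, e k 1]

/-! ### The quaternionic model spaces and the Hopf map -/

instance instMeasurableSpaceQuaternion : MeasurableSpace ℍ[ℝ] := borel ℍ[ℝ]

instance instBorelSpaceQuaternion : BorelSpace ℍ[ℝ] := ⟨rfl⟩

instance instSecondCountableQuaternion : SecondCountableTopology ℍ[ℝ] :=
  haveI : ProperSpace ℍ[ℝ] := FiniteDimensional.proper ℝ ℍ[ℝ]
  inferInstance

/-- `ℍⁿ` with its Euclidean (`ℓ²`) norm, that is, `ℝ⁴ⁿ`. -/
abbrev QSpace (n : ℕ) : Type := PiLp 2 (fun _ : Fin n => ℍ[ℝ])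

/-- The quaternion unit `𝐢`. -/
def qi : ℍ[ℝ] := ⟨0, 1, 0, 0⟩

/-- The quaternion unit `𝐣`. -/
def qj : ℍ[ℝ] := ⟨0, 0, 1, 0⟩

/-- The Hopf map `q ↦ q̄ 𝐢 q`; its values are purely imaginary quaternions, which are
identified with vectors of `ℝ³`. -/
def hopf (q : ℍ[ℝ]) : Vec 3 :=
  !₂[(star q * qi * q).imI, (star q * qi * q).imJ, (star q * qi * q).imK]

/-- The coordinatewise Hopf map, from `ℍⁿ` to lists of `n` edge vectors in `ℝ³`. -/
def hopfMap {n : ℕ} (q : QSpace n) : Fin n → Vec 3 := fun k => hopf (q k)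

/-- The sphere `S^(4n-1)` of radius `√2` in `ℍⁿ`. -/
def spaceSphere (n : ℕ) : Set (QSpace n) := Metric.sphere 0 (√2)

/-- The disjoint union `S^(2n-1) ⊔ S^(2n-1)` of the spheres of radius `√2` in the real subspaces
`(1 ⊕ 𝐣)ⁿ` and `(𝐢 ⊕ 𝐤)ⁿ` of `ℍⁿ`. -/
def planeSpheres (n : ℕ) : Set (QSpace n) :=
  {q | q ∈ Metric.sphere 0 (√2) ∧ ∀ k, (q k).imI = 0 ∧ (q k).imK = 0} ∪
    {q | q ∈ Metric.sphere 0 (√2) ∧ ∀ k, (q k).re = 0 ∧ (q k).imJ = 0}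

/-- The Stiefel manifold `V₂(𝕜ⁿ)` of orthonormal (Hermitian orthonormal if `𝕜 = ℂ`)
`2`-frames in `𝕜ⁿ`. -/
def stiefel (𝕜 : Type) [RCLike 𝕜] (n : ℕ) :
    Set (EuclideanSpace 𝕜 (Fin n) × EuclideanSpace 𝕜 (Fin n)) :=
  {p | Orthonormal 𝕜 ![p.1, p.2]}

/-- The identification `ℂⁿ × ℂⁿ = ℍⁿ`, `(u, v) ↦ u + v 𝐣`. -/
def complexPair {n : ℕ} (p : EuclideanSpace ℂ (Fin n) × EuclideanSpace ℂ (Fin n)) : QSpace n :=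
  WithLp.toLp 2 fun k => (p.1 k : ℍ[ℝ]) + (p.2 k : ℍ[ℝ]) * qj

/-- The inclusion `ℝⁿ × ℝⁿ ⊆ ℍⁿ`, `(u, v) ↦ u + v 𝐣`. -/
def realPair {n : ℕ} (p : EuclideanSpace ℝ (Fin n) × EuclideanSpace ℝ (Fin n)) : QSpace n :=
  WithLp.toLp 2 fun k => (p.1 k : ℍ[ℝ]) + (p.2 k : ℍ[ℝ]) * qj

/-- The Stiefel manifold `V₂(ℂⁿ)` as a subset of `ℍⁿ`. -/
def complexStiefel (n : ℕ) : Set (QSpace n) := complexPair '' stiefel ℂ n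

/-- The Stiefel manifold `V₂(ℝⁿ)` as a subset of `ℍⁿ`. -/
def realStiefel (n : ℕ) : Set (QSpace n) := realPair '' stiefel ℝ n

/-- The disjoint union `V₂(ℝⁿ) ⊔ 𝐢 V₂(ℝⁿ)` as a subset of `ℍⁿ`. -/
def realStiefels (n : ℕ) : Set (QSpace n) :=
  realStiefel n ∪ (fun q : QSpace n => WithLp.toLp 2 fun k => qi * q k) '' realStiefel n

/-! ### Symmetric measures -/

/-- The normalized `m`-dimensional volume on a subset `M` of `ℍⁿ`: the `m`-dimensional Hausdorff
measure restricted to `M`, divided by its total mass. On an `m`-dimensional submanifold the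
Hausdorff measure is a constant multiple of the volume of the Riemannian metric induced from `ℍⁿ`,
and the constant cancels. -/
def normalizedVolume {n : ℕ} (m : ℝ) (M : Set (QSpace n)) : Measure (QSpace n) :=
  ProbabilityTheory.cond (Measure.hausdorffMeasure m) M

/-- The symmetric measure on arms in space:
`μ(U) = Vol(Hopf⁻¹(U) ∩ S^(4n-1)) / Vol(S^(4n-1))` for `U ⊆ Arm 3 n`. -/
def symmArm₃ (n : ℕ) : Measure (Arm 3 n) :=
  ((normalizedVolume (4 * n - 1) (spaceSphere n)).map hopfMap).comap Subtype.val

/-- The symmetric measure on plane arms: the volume of `Hopf⁻¹(U)` in `S^(2n-1) ⊔ S^(2n-1)`,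
normalized, for `U ⊆ Arm 2 n ⊆ Arm 3 n`. -/
def symmArm₂ (n : ℕ) : Measure (Arm 2 n) :=
  ((normalizedVolume (2 * n - 1) (planeSpheres n)).map hopfMap).comap
    fun P => planeToSpace P.1

/-- The symmetric measure on closed space polygons: the volume of `Hopf⁻¹(U)` in `V₂(ℂⁿ)`,
a manifold of dimension `4n - 4`, normalized, for `U ⊆ Pol 3 n`. -/
def symmPol₃ (n : ℕ) : Measure (Pol 3 n) :=
  ((normalizedVolume (4 * n - 4) (complexStiefel n)).map hopfMap).comap Subtype.val

/-- The symmetric measure on closed plane polygons: the volume of `Hopf⁻¹(U)` in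
`V₂(ℝⁿ) ⊔ 𝐢 V₂(ℝⁿ)`, a manifold of dimension `2n - 3`, normalized, for
`U ⊆ Pol 2 n ⊆ Pol 3 n`. -/
def symmPol₂ (n : ℕ) : Measure (Pol 2 n) :=
  ((normalizedVolume (2 * n - 3) (realStiefels n)).map hopfMap).comap
    fun P => planeToSpace P.1

/-! ### Edgelengths -/

/-- The law of the length of the `i`-th edge under a measure on a space of edge lists. -/
def edgelengthLaw {d n : ℕ} {S : Set (Fin n → Vec d)} (μ : Measure S) (i : Fin n) : Measure ℝ :=
  μ.map fun P => ‖P.1 i‖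

/-- The measure on `ℝ` with density `φ` on the interval `[0, L]` and no mass elsewhere. -/
def densityOn (L : ℝ) (φ : ℝ → ℝ) : Measure ℝ :=
  (volume.restrict (Set.Icc 0 L)).withDensity fun y => ENNReal.ofReal (φ y)

/-- The beta distribution with shape parameters `a` and `b`, scaled to the interval `[0, L]`. -/
def betaOn (L a b : ℝ) : Measure ℝ :=
  (betaMeasure a b).map fun x => L * x

end RandomPolygon

end

open MeasureTheory ProbabilityTheory
open scoped Quaternion ENNReal

/-! Since ‖q̄ 𝐢 q‖ = ‖q‖², the length of the ith edge is ‖q i‖² upstairs, so every claim concerns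
the law of one squared coordinate norm on a sphere or a Stiefel manifold
(`edgelengthLaw_comap_hopfMap`). For plane polygons, left multiplication by 𝐢 is an isometry that
exchanges the two components and leaves the Hopf map unchanged, so one component suffices
(`map_cond_union_image`).

Arms: the volume of a sphere is rotation invariant, and an invariant probability measure on a sphere
is unique (`eq_of_invariant_of_sphere`). It can therefore be replaced by the normalized radial
projection of the weight exp(-‖x‖²). Under that weight the squared norms s, t of complementary
blocks are independent gamma variables, and s / (s + t) is beta, with half the real dimensions of
the blocks as parameters (`map_sum_norm_sq_cond_sphere`).

Closed polygons: for a frame (u, v), the number ‖u i‖² + ‖v i‖² is the squared length of the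
projection of the ith basis vector to the span of the frame. By invariance, a random frame and a
fixed unit vector may be traded for a fixed frame and a random unit vector
(`map_sum_norm_inner_sq_eq`). This leaves the law of two squared coordinates on the unit sphere of
𝕜ⁿ, again a beta law.

Normalizing Hausdorff measure requires its mass to be positive and finite; this follows from the
implicit function theorem (`hausdorffMeasure_levelSet_pos_and_lt_top`). -/

namespace RandomPolygon

/-! ### Hausdorff measure of regular level sets. -/

section LevelSets

open Filter Topology Module

variable {E F G : Type*} [NormedAddCommGroup E] [NormedSpace ℝ E]
  [MeasurableSpace E] [BorelSpace E] [NormedAddCommGroup F] [NormedSpace ℝ F]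

/-- A regular level set has locally finite Hausdorff measure, in the dimension of the parameter
space of the implicit function. -/
theorem finiteAtFilter_hausdorffMeasure_levelSet [NormedAddCommGroup G] [NormedSpace ℝ G]
    [FiniteDimensional ℝ G] [CompleteSpace E] [CompleteSpace F] [CompleteSpace G]
    (φ : ImplicitFunctionData ℝ E F G) :
    (Measure.hausdorffMeasure (finrank ℝ G) : Measure E).FiniteAtFilter
      (𝓝[φ.leftFun ⁻¹' {φ.leftFun φ.pt}] φ.pt) := by
  borelize G
  obtain ⟨K, s, hs, hK⟩ := φ.hasStrictFDerivAt_implicitFunction_fderiv.exists_lipschitzOnWith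
  obtain ⟨t, ht, htf⟩ :=
    (Measure.hausdorffMeasure (finrank ℝ G) : Measure G).finiteAt_nhds (φ.rightFun φ.pt)
  have hmap := φ.map_implicitFunction_nhdsWithin_preimage Set.univ
  simp only [Set.preimage_univ, nhdsWithin_univ, Set.univ_inter] at hmap
  -- By `hmap` the implicit function parametrizes the level set near the point. It is Lipschitz
  -- there, so it multiplies Hausdorff measure by a bounded factor at most.
  refine ⟨φ.implicitFunction (φ.leftFun φ.pt) '' (s ∩ t), ?_, ?_⟩
  · rw [← hmap]
    exact image_mem_map (inter_mem hs ht)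
  · refine ((hK.mono Set.inter_subset_left).hausdorffMeasure_image_le (by positivity)).trans_lt ?_
    exact ENNReal.mul_lt_top (ENNReal.rpow_lt_top_of_nonneg (by positivity) ENNReal.coe_ne_top)
      ((measure_mono Set.inter_subset_right).trans_lt htf)

/-- A regular level set has positive Hausdorff measure, in the dimension of the parameter
space of the implicit function. -/
theorem hausdorffMeasure_levelSet_pos [NormedAddCommGroup G] [NormedSpace ℝ G]
    [FiniteDimensional ℝ G] [CompleteSpace E] [CompleteSpace F] [CompleteSpace G]
    (φ : ImplicitFunctionData ℝ E F G) :
    0 < (Measure.hausdorffMeasure (finrank ℝ G) : Measure E)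
      (φ.leftFun ⁻¹' {φ.leftFun φ.pt}) := by
  borelize G
  set ψ := φ.implicitFunction (φ.leftFun φ.pt) with hψ
  obtain ⟨K, s, hs, hK⟩ := φ.hasStrictFDerivAt_rightFun.exists_lipschitzOnWith
  have hmap := φ.map_implicitFunction_nhdsWithin_preimage Set.univ
  simp only [Set.preimage_univ, nhdsWithin_univ, Set.univ_inter] at hmap
  have hs' : s ∩ φ.leftFun ⁻¹' {φ.leftFun φ.pt} ∈ map ψ (𝓝 (φ.rightFun φ.pt)) := by
    rw [hψ, hmap, Set.inter_comm]
    exact inter_mem_nhdsWithin _ hs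
  have hr : ∀ᶠ y in 𝓝 (φ.rightFun φ.pt), φ.rightFun (ψ y) = y := by
    have h : ∀ᶠ p : F × G in 𝓝 (φ.leftFun φ.pt, φ.rightFun φ.pt),
        φ.rightFun (φ.implicitFunction p.1 p.2) = p.2 := φ.rightFun_implicitFunction
    exact h.curry_nhds.self_of_nhds
  -- The Lipschitz map `rightFun` undoes `ψ` on `t`, so the neighbourhood `t` is a Lipschitz image
  -- of a piece of the level set, which therefore cannot be null.
  set t := {y | ψ y ∈ s ∩ φ.leftFun ⁻¹' {φ.leftFun φ.pt} ∧ φ.rightFun (ψ y) = y}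
  have ht : t ∈ 𝓝 (φ.rightFun φ.pt) := inter_mem hs' hr
  have himg : φ.rightFun '' (ψ '' t) = t := by
    rw [Set.image_image]
    exact (Set.image_congr fun y hy => hy.2).trans (Set.image_id' t)
  have hpos : 0 < (Measure.hausdorffMeasure (finrank ℝ G) : Measure G) t :=
    Measure.measure_pos_of_mem_nhds _ ht
  have hle := (hK.mono (s := ψ '' t) (by rintro _ ⟨y, hy, rfl⟩; exact hy.1.1)
    ).hausdorffMeasure_image_le (d := finrank ℝ G) (by positivity)
  rw [himg] at hle
  refine (ENNReal.mul_pos_iff.mp (hpos.trans_le hle)).2.trans_le (measure_mono ?_)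
  rintro _ ⟨y, hy, rfl⟩
  exact hy.1.2

/-- A compact nonempty level set all of whose points are regular has positive finite Hausdorff
measure in its dimension. -/
theorem hausdorffMeasure_levelSet_pos_and_lt_top [FiniteDimensional ℝ E]
    [FiniteDimensional ℝ F] {f : E → F} {f' : E → E →L[ℝ] F} {c : F} {m : ℝ}
    (hcpt : IsCompact (f ⁻¹' {c})) (hne : (f ⁻¹' {c}).Nonempty)
    (hf : ∀ x ∈ f ⁻¹' {c}, HasStrictFDerivAt f (f' x) x)
    (hsurj : ∀ x ∈ f ⁻¹' {c}, Function.Surjective (f' x))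
    (hm : m = (finrank ℝ E : ℝ) - finrank ℝ F) :
    0 < (Measure.hausdorffMeasure m : Measure E) (f ⁻¹' {c}) ∧
      (Measure.hausdorffMeasure m : Measure E) (f ⁻¹' {c}) < ∞ := by
  have hdata : ∀ x ∈ f ⁻¹' {c}, ∃ φ : ImplicitFunctionData ℝ E F (f' x).ker,
      φ.leftFun = f ∧ φ.pt = x := fun x hx =>
    ⟨HasStrictFDerivAt.implicitFunctionDataOfComplemented f (f' x) (hf x hx)
      (LinearMap.range_eq_top.2 (hsurj x hx))
      (ContinuousLinearMap.ker_closedComplemented_of_finiteDimensional_range _), rfl, rfl⟩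
  have hdim : ∀ x ∈ f ⁻¹' {c}, (finrank ℝ (f' x).ker : ℝ) = m := fun x hx => by
    have h := LinearMap.finrank_range_add_finrank_ker (f' x : E →ₗ[ℝ] F)
    rw [LinearMap.range_eq_top.2 (hsurj x hx), finrank_top] at h
    rw [hm, ← h]
    push_cast
    ring
  constructor
  · obtain ⟨x, hx⟩ := hne
    obtain ⟨φ, h1, h2⟩ := hdata x hx
    have h := hausdorffMeasure_levelSet_pos φ
    rwa [hdim x hx, h1, h2, show f x = c from hx] at h
  · refine hcpt.measure_lt_top_of_nhdsWithin fun x hx => ?_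
    obtain ⟨φ, h1, h2⟩ := hdata x hx
    have h := finiteAtFilter_hausdorffMeasure_levelSet φ
    rwa [hdim x hx, h1, h2, show f x = c from hx] at h

end LevelSets

/-! ### Polar coordinates, gamma and beta distributions. -/

section GammaBeta

open Set Module

/-- Integration of a radial function in polar coordinates. -/
theorem lintegral_comp_norm {E : Type*} [NormedAddCommGroup E] [NormedSpace ℝ E]
    [FiniteDimensional ℝ E] [MeasurableSpace E] [BorelSpace E] [Nontrivial E]
    (μ : Measure E) [μ.IsAddHaarMeasure] {f : ℝ → ℝ≥0∞} (hf : Measurable f) :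
    ∫⁻ x, f ‖x‖ ∂μ =
      μ.toSphere univ * ∫⁻ r in Ioi 0, ENNReal.ofReal (r ^ (finrank ℝ E - 1)) * f r := by
  calc
    ∫⁻ x, f ‖x‖ ∂μ = ∫⁻ x : ({(0)}ᶜ : Set E), f ‖x.1‖ ∂(μ.comap (↑)) := by
      rw [lintegral_subtype_comap (measurableSet_singleton _).compl fun x => f ‖x‖,
        restrict_compl_singleton]
    _ = ∫⁻ x, f x.2 ∂μ.toSphere.prod (.volumeIoiPow (finrank ℝ E - 1)) := by
      rw [← μ.measurePreserving_homeomorphUnitSphereProd.lintegral_comp (by fun_prop)]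
      simp
    _ = μ.toSphere univ * ∫⁻ x : Ioi (0 : ℝ), f x ∂.volumeIoiPow (finrank ℝ E - 1) := by
      rw [lintegral_prod _ (by fun_prop)]
      simp [mul_comm]
    _ = _ := by
      congr 1
      rw [Measure.volumeIoiPow, lintegral_withDensity_eq_lintegral_mul _ (by fun_prop)
        (by fun_prop), ← lintegral_subtype_comap measurableSet_Ioi]
      rfl

theorem setLIntegral_comp_sq (g : ℝ → ℝ≥0∞) :
    ∫⁻ s in Ioi 0, g s = ∫⁻ r in Ioi 0, ENNReal.ofReal (2 * r) * g (r ^ 2) := by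
  have himg : (fun r : ℝ => r ^ 2) '' Ioi 0 = Ioi 0 := by
    ext s
    constructor
    · rintro ⟨r, hr, rfl⟩
      exact pow_pos (mem_Ioi.1 hr) 2
    · intro hs
      exact ⟨√s, Real.sqrt_pos.2 hs, Real.sq_sqrt (le_of_lt hs)⟩
  have hinj : InjOn (fun r : ℝ => r ^ 2) (Ioi 0) := fun x hx y hy h =>
    (pow_left_inj₀ (le_of_lt hx) (le_of_lt hy) two_ne_zero).1 h
  have h := lintegral_image_eq_lintegral_abs_deriv_mul (measurableSet_Ioi (a := (0 : ℝ)))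
    (f := fun r => r ^ 2) (f' := fun r => 2 * r)
    (fun x _ => by simpa using (hasDerivAt_pow 2 x).hasDerivWithinAt) hinj g
  rw [himg] at h
  rw [h]
  refine setLIntegral_congr_fun measurableSet_Ioi fun r hr => ?_
  have : (0 : ℝ) < r := hr
  simp only [abs_of_pos (by positivity : 0 < 2 * r)]

theorem lintegral_gammaMeasure {a r : ℝ} {f : ℝ → ℝ≥0∞} (hf : Measurable f) :
    ∫⁻ x, f x ∂gammaMeasure a r = ∫⁻ x in Ioi 0, gammaPDF a r x * f x := by
  have hm : Measurable (gammaPDF a r) := (measurable_gammaPDFReal a r).ennreal_ofReal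
  rw [gammaMeasure, lintegral_withDensity_eq_lintegral_mul _ hm hf,
    setLIntegral_congr Ioi_ae_eq_Ici, ← lintegral_indicator measurableSet_Ici]
  refine lintegral_congr fun x => ?_
  by_cases hx : 0 ≤ x
  · simp [hx]
  · simp [hx, gammaPDF_of_neg (not_le.1 hx)]

/-- Under the weight `exp (-‖x‖²)`, the squared norm is gamma distributed, up to normalization. -/
theorem exists_lintegral_norm_sq_exp {E : Type*} [NormedAddCommGroup E] [NormedSpace ℝ E]
    [FiniteDimensional ℝ E] [MeasurableSpace E] [BorelSpace E] [Nontrivial E]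
    (μ : Measure E) [μ.IsAddHaarMeasure] :
    ∃ c : ℝ≥0∞, c ≠ 0 ∧ c ≠ ∞ ∧ ∀ h : ℝ → ℝ≥0∞, Measurable h →
      ∫⁻ x, h (‖x‖ ^ 2) * ENNReal.ofReal (Real.exp (-‖x‖ ^ 2)) ∂μ =
        c * ∫⁻ s, h s ∂gammaMeasure (finrank ℝ E / 2) 1 := by
  have hdim : 0 < finrank ℝ E := finrank_pos
  have hG : 0 < Real.Gamma (finrank ℝ E / 2) := Real.Gamma_pos_of_pos (by positivity)
  -- With d the dimension and s = r², ∫ r^(d-1) e^(-r²) h(r²) dr = ½ ∫ s^(d/2-1) e^(-s) h(s) ds. The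
  -- constant is the area of the unit sphere times Γ(d/2)/2.
  refine ⟨μ.toSphere univ * ENNReal.ofReal (Real.Gamma (finrank ℝ E / 2) / 2), ?_, ?_, ?_⟩
  · have h1 : ENNReal.ofReal (Real.Gamma (finrank ℝ E / 2) / 2) ≠ 0 := by
      simpa using hG
    have h2 : μ.toSphere univ ≠ 0 :=
      Measure.measure_univ_ne_zero.2 μ.toSphere_ne_zero
    exact mul_ne_zero h2 h1
  · exact ENNReal.mul_ne_top (measure_ne_top _ _) ENNReal.ofReal_ne_top
  intro h hh
  rw [lintegral_comp_norm μ (f := fun r => h (r ^ 2) * ENNReal.ofReal (Real.exp (-r ^ 2)))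
    (by fun_prop), mul_assoc, lintegral_gammaMeasure hh,
    setLIntegral_comp_sq (fun s => gammaPDF (finrank ℝ E / 2) 1 s * h s),
    ← lintegral_const_mul' _ _ ENNReal.ofReal_ne_top]
  congr 1
  refine setLIntegral_congr_fun measurableSet_Ioi fun r hr => ?_
  have hr : (0 : ℝ) < r := hr
  have hpow : r * (r ^ 2) ^ ((finrank ℝ E : ℝ) / 2 - 1) = r ^ (finrank ℝ E - 1) := by
    rw [← Real.rpow_natCast r 2, ← Real.rpow_mul hr.le, ← Real.rpow_natCast r (finrank ℝ E - 1)]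
    nth_rewrite 1 [← Real.rpow_one r]
    rw [← Real.rpow_add hr, Nat.cast_sub hdim]
    congr 1
    push_cast
    ring
  rw [gammaPDF_of_nonneg (sq_nonneg r), ← hpow, mul_comm (h (r ^ 2)),
    ← mul_assoc, ← mul_assoc, ← mul_assoc,
    ← ENNReal.ofReal_mul (by positivity), ← ENNReal.ofReal_mul (by positivity),
    ← ENNReal.ofReal_mul (by positivity)]
  congr 2
  field_simp
  simp

/-- If `s` and `t` are independent and gamma distributed with the same rate, then `s / (s + t)` is
beta distributed. -/
theorem lintegral_lintegral_gammaMeasure_div_add {a b : ℝ} (ha : 0 < a) (hb : 0 < b)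
    {f : ℝ → ℝ≥0∞} (hf : Measurable f) :
    ∫⁻ s, ∫⁻ t, f (s / (s + t)) ∂gammaMeasure b 1 ∂gammaMeasure a 1 =
      ∫⁻ x, f x ∂betaMeasure a b := by
  -- For fixed s, substitute x = s / (s + t), that is t = s/x - s, with Jacobian s/x².
  have hsub : ∀ s : ℝ, 0 < s → ∀ g : ℝ → ℝ≥0∞, ∫⁻ t in Ioi 0, g t =
      ∫⁻ x in Ioo 0 1, ENNReal.ofReal (s / x ^ 2) * g (s / x - s) := by
    intro s hs g
    have himg : (fun x : ℝ => s / x - s) '' Ioo 0 1 = Ioi 0 := by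
      ext t
      constructor
      · rintro ⟨x, ⟨hx0, hx1⟩, rfl⟩
        simp only [mem_Ioi, sub_pos]
        rw [lt_div_iff₀ hx0]
        nlinarith
      · intro (ht : 0 < t)
        refine ⟨s / (s + t), ⟨by positivity, ?_⟩, ?_⟩
        · rw [div_lt_one (by positivity)]
          linarith
        · field_simp
          ring
    have hinj : InjOn (fun x : ℝ => s / x - s) (Ioo 0 1) := by
      intro x hx y hy h
      have hx0 := hx.1.ne'
      have hy0 := hy.1.ne'
      simp only [sub_left_inj] at h
      rw [div_eq_div_iff hx0 hy0] at h
      exact (mul_left_cancel₀ hs.ne' h).symm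
    have h := lintegral_image_eq_lintegral_abs_deriv_mul (measurableSet_Ioo (a := (0 : ℝ)) (b := 1))
      (f := fun x => s / x - s) (f' := fun x => -(s / x ^ 2))
      (fun x hx => by
        have := ((hasDerivAt_inv hx.1.ne').const_mul s).sub_const s
        simpa [div_eq_mul_inv] using this.hasDerivWithinAt) hinj g
    rw [himg] at h
    rw [h]
    refine setLIntegral_congr_fun measurableSet_Ioo fun x hx => ?_
    have : (0 : ℝ) < x := hx.1
    simp only [abs_neg, abs_of_pos (by positivity : 0 < s / x ^ 2)]
  -- The exponentials combine to e^(-s/x), so the joint density is the beta density of x times the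
  -- gamma density of s with rate 1/x. The latter integrates to 1 in s, whatever x is.
  have hkey : ∀ s : ℝ, 0 < s → ∀ x ∈ Ioo (0 : ℝ) 1,
      gammaPDF a 1 s * (ENNReal.ofReal (s / x ^ 2) * (gammaPDF b 1 (s / x - s) *
        f (s / (s + (s / x - s))))) =
      betaPDF a b x * f x * gammaPDF (a + b) (1 / x) s := by
    intro s hs x hx
    have hx0 := hx.1
    have hx1 : 0 < 1 - x := sub_pos.2 hx.2
    have hsx : s / x - s = s * (1 - x) / x := by field_simp
    have hdiv : s / (s + (s / x - s)) = x := by field_simp; ring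
    have hGa := Real.Gamma_pos_of_pos ha
    have hGb := Real.Gamma_pos_of_pos hb
    have hGab := Real.Gamma_pos_of_pos (add_pos ha hb)
    rw [hdiv, gammaPDF_of_nonneg hs.le, gammaPDF_of_nonneg (by rw [hsx]; positivity),
      gammaPDF_of_nonneg hs.le, betaPDF_of_pos_lt_one hx.1 hx.2]
    rw [mul_right_comm _ (f x), ← mul_assoc, ← mul_assoc]
    rw [← ENNReal.ofReal_mul (by positivity), ← ENNReal.ofReal_mul (by positivity),
      ← ENNReal.ofReal_mul (by unfold beta; positivity)]
    congr 2
    have hexp : Real.exp (-(1 * s)) * Real.exp (-(1 * (s / x - s))) = Real.exp (-(1 / x * s)) := by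
      rw [← Real.exp_add]
      congr 1
      ring
    have hA : (s * (1 - x) / x) ^ (b - 1) = s ^ (b - 1) * (1 - x) ^ (b - 1) / x ^ (b - 1) := by
      rw [Real.div_rpow (by positivity) hx0.le, Real.mul_rpow hs.le hx1.le]
    have hs' : s ^ (a + b - 1) = s ^ (a - 1) * s ^ (b - 1) * s := by
      nth_rewrite 4 [← Real.rpow_one s]
      rw [← Real.rpow_add hs, ← Real.rpow_add hs]
      congr 1
      ring
    have hxx : (1 / x) ^ (a + b) = 1 / (x ^ (a - 1) * x ^ (b - 1) * x ^ 2) := by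
      rw [Real.div_rpow zero_le_one hx0.le, Real.one_rpow, ← Real.rpow_natCast x 2,
        ← Real.rpow_add hx0, ← Real.rpow_add hx0]
      congr 2
      push_cast
      ring
    rw [← hexp, hsx, hA, hs', hxx, beta]
    simp only [Real.one_rpow]
    field_simp
  have := isProbabilityMeasure_gammaMeasure hb one_pos
  rw [lintegral_gammaMeasure (Measurable.lintegral_prod_right' (f := fun p : ℝ × ℝ =>
    f (p.1 / (p.1 + p.2))) (by fun_prop))]
  have hmg : ∀ a r, Measurable (gammaPDF a r) := fun a r =>
    (measurable_gammaPDFReal a r).ennreal_ofReal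
  have hmb : Measurable (betaPDF a b) := (measurable_betaPDFReal a b).ennreal_ofReal
  calc
    _ = ∫⁻ s in Ioi 0, ∫⁻ x in Ioo (0 : ℝ) 1,
          betaPDF a b x * f x * gammaPDF (a + b) (1 / x) s := by
      refine setLIntegral_congr_fun measurableSet_Ioi fun s hs => ?_
      simp only
      rw [lintegral_gammaMeasure (by fun_prop), hsub s hs,
        ← lintegral_const_mul' _ _ (show gammaPDF a 1 s ≠ ∞ from ENNReal.ofReal_ne_top)]
      exact setLIntegral_congr_fun measurableSet_Ioo (hkey s hs)
    _ = ∫⁻ x in Ioo (0 : ℝ) 1, ∫⁻ s in Ioi 0,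
          betaPDF a b x * f x * gammaPDF (a + b) (1 / x) s := by
      refine lintegral_lintegral_swap (Measurable.aemeasurable ?_)
      have : Measurable fun p : ℝ × ℝ => gammaPDF (a + b) (1 / p.2) p.1 := by
        unfold gammaPDF gammaPDFReal
        refine Measurable.ennreal_ofReal (Measurable.ite ?_ (by fun_prop) (by fun_prop))
        exact measurableSet_le measurable_const measurable_fst
      exact ((hmb.mul hf).comp measurable_snd).mul this
    _ = ∫⁻ x in Ioo (0 : ℝ) 1, betaPDF a b x * f x := by
      refine setLIntegral_congr_fun measurableSet_Ioo fun x hx => ?_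
      rw [lintegral_const_mul _ (hmg _ _)]
      have h1 := lintegral_gammaMeasure (a := a + b) (r := 1 / x) (f := fun _ => 1)
        measurable_const
      have h2 := isProbabilityMeasure_gammaMeasure (add_pos ha hb) (one_div_pos.2 hx.1)
      simp only [lintegral_const, measure_univ, mul_one] at h1
      rw [← h1, mul_one]
    _ = _ := by
      rw [betaMeasure, lintegral_withDensity_eq_lintegral_mul _ hmb hf,
        ← lintegral_indicator measurableSet_Ioo]
      refine lintegral_congr fun x => ?_
      by_cases hx : x ∈ Ioo (0 : ℝ) 1
      · simp [hx]
      · simp only [hx, not_false_eq_true, indicator_of_notMem, Pi.mul_apply]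
        rw [betaPDF_eq, if_neg (by simpa using hx)]
        simp

end GammaBeta

/-! ### Exchange of randomness, and uniqueness of the invariant measure on a sphere. -/

section InvariantMeasures

open Set Module

/-- If the law of `Φ x` under `σ` does not depend on `x ∈ M` and the law of `Φ · y` under `μ` does
not depend on `y ∈ S`, then all these laws agree. -/
theorem map_eq_map_of_forall_map_eq {X Y Z : Type*} [MeasurableSpace X] [MeasurableSpace Y]
    [MeasurableSpace Z] {μ : Measure X} {σ : Measure Y} [IsProbabilityMeasure μ]
    [IsProbabilityMeasure σ] {Φ : X → Y → Z} (hΦ : Measurable (Function.uncurry Φ))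
    {M : Set X} {S : Set Y} (hM : ∀ᵐ x ∂μ, x ∈ M) (hS : ∀ᵐ y ∂σ, y ∈ S)
    (hσ : ∀ x ∈ M, ∀ x' ∈ M, σ.map (Φ x) = σ.map (Φ x'))
    (hμ : ∀ y ∈ S, ∀ y' ∈ S, μ.map (Φ · y) = μ.map (Φ · y'))
    {x₀ : X} (hx₀ : x₀ ∈ M) {y₀ : Y} (hy₀ : y₀ ∈ S) :
    μ.map (Φ · y₀) = σ.map (Φ x₀) := by
  have h1 : ∀ x, Measurable (Φ x) := fun x => hΦ.comp measurable_prodMk_left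
  have h2 : ∀ y, Measurable (Φ · y) := fun y => hΦ.comp measurable_prodMk_right
  ext B hB
  -- Tonelli in both orders: almost all slices in either direction have the same measure, so the
  -- product measure of Φ⁻¹(B) equals each of the two laws of B.
  have hl : (μ.prod σ) (Function.uncurry Φ ⁻¹' B) = σ.map (Φ x₀) B := by
    rw [Measure.prod_apply (hΦ hB)]
    calc _ = ∫⁻ _, σ.map (Φ x₀) B ∂μ := by
          refine lintegral_congr_ae (hM.mono fun x hx => ?_)
          simp only
          rw [← hσ x hx x₀ hx₀, Measure.map_apply (h1 x) hB]
          rfl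
      _ = _ := by simp
  have hr : (μ.prod σ) (Function.uncurry Φ ⁻¹' B) = μ.map (Φ · y₀) B := by
    rw [Measure.prod_apply_symm (hΦ hB)]
    calc _ = ∫⁻ _, μ.map (Φ · y₀) B ∂σ := by
          refine lintegral_congr_ae (hS.mono fun y hy => ?_)
          simp only
          rw [← hμ y hy y₀ hy₀, Measure.map_apply (h2 y) hB]
          rfl
      _ = _ := by simp
  rw [← hr, hl]

/-- Two probability measures on a sphere which are invariant under all linear isometries agree. -/
theorem eq_of_invariant_of_sphere {V : Type*} [NormedAddCommGroup V] [InnerProductSpace ℝ V]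
    [FiniteDimensional ℝ V] [MeasurableSpace V] [BorelSpace V] {μ σ : Measure V}
    [IsProbabilityMeasure μ] [IsProbabilityMeasure σ] {R : ℝ} (hR : 0 < R)
    (hμR : ∀ᵐ x ∂μ, ‖x‖ = R) (hσR : ∀ᵐ x ∂σ, ‖x‖ = R)
    (hμ : ∀ g : V ≃ₗᵢ[ℝ] V, μ.map g = μ) (hσ : ∀ g : V ≃ₗᵢ[ℝ] V, σ.map g = σ) : μ = σ := by
  have : SecondCountableTopology V := by
    have : ProperSpace V := FiniteDimensional.proper ℝ V
    infer_instance
  -- The reflection in the hyperplane orthogonal to x - x' carries x to x'.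
  have hinv : ∀ ν : Measure V, (∀ g : V ≃ₗᵢ[ℝ] V, ν.map g = ν) → ∀ x x' : V, ‖x‖ = R → ‖x'‖ = R →
      ν.map (fun y => inner ℝ x y) = ν.map (fun y => inner ℝ x' y) := by
    intro ν hν x x' hx hx'
    set g := (ℝ ∙ (x - x'))ᗮ.reflection
    have hg : g x = x' := Submodule.reflection_sub (hx.trans hx'.symm)
    conv_lhs => rw [show (fun y => inner ℝ x y) = (fun y => inner ℝ x' y) ∘ g by
      funext y
      simp only [Function.comp_apply]
      rw [← hg, g.inner_map_map]]
    rw [← Measure.map_map (by fun_prop) g.continuous.measurable, hν g]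
  have hsame : ∀ y₀ : V, ‖y₀‖ = R →
      μ.map (fun x => inner ℝ x y₀) = σ.map (fun x => inner ℝ x y₀) := by
    intro y₀ hy₀
    have h := map_eq_map_of_forall_map_eq (μ := μ) (σ := σ) (Φ := fun x y : V => inner ℝ x y)
      (M := {x | ‖x‖ = R}) (S := {x | ‖x‖ = R})
      (by
        have : Continuous (Function.uncurry fun x y : V => inner ℝ x y) := by
          unfold Function.uncurry; fun_prop
        exact this.measurable) hμR hσR
      (fun x hx x' hx' => hinv σ hσ x x' hx hx')
      (fun y hy y' hy' => by
        simpa only [real_inner_comm] using hinv μ hμ y y' hy hy') (x₀ := y₀) hy₀ (y₀ := y₀) hy₀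
    simpa only [real_inner_comm] using h
  refine Measure.ext_of_charFun (funext fun t => ?_)
  rcases eq_or_ne t 0 with rfl | ht
  · simp
  have hnt : 0 < ‖t‖ := norm_pos_iff.2 ht
  set y₀ := (R / ‖t‖) • t with hy₀
  have hy₀R : ‖y₀‖ = R := by
    rw [hy₀, norm_smul, Real.norm_of_nonneg (by positivity)]
    field_simp
  -- The characteristic function at t sees only the marginal in direction t, here rescaled to radius
  -- R so that `hsame` applies.
  have key : ∀ ν : Measure V, charFun ν t =
      ∫ z, Complex.exp ((‖t‖ / R * z : ℝ) * Complex.I) ∂(ν.map fun x => inner ℝ x y₀) := by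
    intro ν
    rw [charFun_apply, integral_map (by fun_prop) (by fun_prop)]
    refine integral_congr_ae (Filter.Eventually.of_forall fun x => ?_)
    have : inner ℝ x t = ‖t‖ / R * inner ℝ x y₀ := by
      rw [hy₀, inner_smul_right]
      field_simp
    simp only [this]
  rw [key, key, hsame y₀ hy₀R]

end InvariantMeasures

/-! ### The invariant measure on a sphere as a projected Gaussian weight. -/

section Sphere

open Set Module

variable {ι : Type*} [Fintype ι]

/-- The volume of a Euclidean space is the product of the volumes of two complementary
coordinate subspaces. -/
theorem measurePreserving_euclideanSpace_subtype_prod (p : ι → Prop) [DecidablePred p]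
    [h₁ : Fintype {i // p i}] [h₂ : Fintype {i // ¬p i}] :
    MeasurePreserving (fun x : EuclideanSpace ℝ ι =>
      ((WithLp.toLp 2 fun i => x i, WithLp.toLp 2 fun i => x i) :
        EuclideanSpace ℝ {i // p i} × EuclideanSpace ℝ {i // ¬p i})) := by
  obtain rfl : h₁ = Subtype.fintype p := Subsingleton.elim _ _
  obtain rfl : h₂ = Subtype.fintype fun i => ¬p i := Subsingleton.elim _ _
  exact ((PiLp.volume_preserving_toLp _).prod (PiLp.volume_preserving_toLp _)).comp
    ((volume_preserving_piEquivPiSubtypeProd (fun _ : ι => ℝ) p).comp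
      (PiLp.volume_preserving_ofLp ι))

/-- Under the weight `exp (-‖x‖²)`, the fraction of the squared norm carried by a set of
coordinates is beta distributed, up to normalization. -/
theorem exists_lintegral_sum_sq_div_norm_sq [DecidableEq ι] {s : Finset ι} (hs : s.Nonempty)
    (hs' : sᶜ.Nonempty) :
    ∃ c : ℝ≥0∞, c ≠ 0 ∧ c ≠ ∞ ∧ ∀ f : ℝ → ℝ≥0∞, Measurable f →
      ∫⁻ x : EuclideanSpace ℝ ι, f ((∑ i ∈ s, x i ^ 2) / ‖x‖ ^ 2) *
          ENNReal.ofReal (Real.exp (-‖x‖ ^ 2)) =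
        c * ∫⁻ x, f x ∂betaMeasure (s.card / 2) (sᶜ.card / 2) := by
  have : Nonempty {i // i ∈ s} := hs.to_subtype
  have : Nonempty {i // i ∉ s} := by
    obtain ⟨i, hi⟩ := hs'
    exact ⟨i, Finset.mem_compl.1 hi⟩
  obtain ⟨c₁, h10, h1t, h1⟩ := exists_lintegral_norm_sq_exp
    (volume : Measure (EuclideanSpace ℝ {i // i ∈ s}))
  obtain ⟨c₂, h20, h2t, h2⟩ := exists_lintegral_norm_sq_exp
    (volume : Measure (EuclideanSpace ℝ {i // i ∉ s}))
  have hc1 : (finrank ℝ (EuclideanSpace ℝ {i // i ∈ s}) : ℝ) = s.card := by simp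
  have hc2 : (finrank ℝ (EuclideanSpace ℝ {i // i ∉ s}) : ℝ) = sᶜ.card := by
    rw [finrank_euclideanSpace, Fintype.card_subtype_compl, Finset.card_compl, Fintype.card_coe]
  rw [hc1] at h1
  rw [hc2] at h2
  have hp1 : (0 : ℝ) < s.card / 2 := by have := hs.card_pos; positivity
  have hp2 : (0 : ℝ) < sᶜ.card / 2 := by have := hs'.card_pos; positivity
  refine ⟨c₁ * c₂, mul_ne_zero h10 h20, ENNReal.mul_ne_top h1t h2t, fun f hf => ?_⟩
  rw [← lintegral_lintegral_gammaMeasure_div_add hp1 hp2 hf]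
  have := isProbabilityMeasure_gammaMeasure hp2 one_pos
  have hT : MeasurePreserving (fun x : EuclideanSpace ℝ ι =>
      ((WithLp.toLp 2 fun i => x i, WithLp.toLp 2 fun i => x i) :
        EuclideanSpace ℝ {i // i ∈ s} × EuclideanSpace ℝ {i // i ∉ s})) :=
    measurePreserving_euclideanSpace_subtype_prod _
  have hsum : ∀ x : EuclideanSpace ℝ ι, ∑ i ∈ s, x i ^ 2 =
      ‖(WithLp.toLp 2 fun i => x i : EuclideanSpace ℝ {i // i ∈ s})‖ ^ 2 := by
    intro x
    rw [EuclideanSpace.real_norm_sq_eq, ← Finset.sum_coe_sort]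
  have hsum' : ∀ x : EuclideanSpace ℝ ι, ‖x‖ ^ 2 =
      ‖(WithLp.toLp 2 fun i => x i : EuclideanSpace ℝ {i // i ∈ s})‖ ^ 2 +
      ‖(WithLp.toLp 2 fun i => x i : EuclideanSpace ℝ {i // i ∉ s})‖ ^ 2 := by
    intro x
    rw [EuclideanSpace.real_norm_sq_eq, EuclideanSpace.real_norm_sq_eq,
      EuclideanSpace.real_norm_sq_eq]
    convert! (Fintype.sum_subtype_add_sum_subtype (fun i => i ∈ s) fun i => x i ^ 2).symm
  -- The weight splits over the two blocks because ‖x‖² does. Integrating out each block in turn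
  -- yields a gamma law and one of the factors c₁, c₂.
  set G : EuclideanSpace ℝ {i // i ∈ s} × EuclideanSpace ℝ {i // i ∉ s} → ℝ≥0∞ := fun q =>
    f (‖q.1‖ ^ 2 / (‖q.1‖ ^ 2 + ‖q.2‖ ^ 2)) * ENNReal.ofReal (Real.exp (-‖q.2‖ ^ 2)) *
      ENNReal.ofReal (Real.exp (-‖q.1‖ ^ 2)) with hG
  have hGm : Measurable G := by fun_prop
  have hcongr : ∀ x : EuclideanSpace ℝ ι, f ((∑ i ∈ s, x i ^ 2) / ‖x‖ ^ 2) *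
      ENNReal.ofReal (Real.exp (-‖x‖ ^ 2)) =
        G (WithLp.toLp 2 fun i => x i, WithLp.toLp 2 fun i => x i) := by
    intro x
    simp only [hG]
    rw [← hsum' x, ← hsum x, mul_assoc, ← ENNReal.ofReal_mul (Real.exp_nonneg _), ← Real.exp_add,
      hsum' x, ← hsum x]
    congr 3
    ring
  refine ((lintegral_congr hcongr).trans (hT.lintegral_comp hGm)).trans ?_
  rw [Measure.volume_eq_prod, lintegral_prod _ hGm.aemeasurable]
  calc
    _ = ∫⁻ u : EuclideanSpace ℝ {i // i ∈ s}, c₂ *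
          ((∫⁻ t, f (‖u‖ ^ 2 / (‖u‖ ^ 2 + t)) ∂gammaMeasure (sᶜ.card / 2) 1) *
            ENNReal.ofReal (Real.exp (-‖u‖ ^ 2))) := by
      refine lintegral_congr fun u => ?_
      simp only [hG]
      rw [lintegral_mul_const' _ _ ENNReal.ofReal_ne_top,
        h2 (fun t => f (‖u‖ ^ 2 / (‖u‖ ^ 2 + t))) (by fun_prop), mul_assoc]
    _ = _ := by
      rw [lintegral_const_mul' _ _ h2t, h1 (fun s' => ∫⁻ t, f (s' / (s' + t))
        ∂gammaMeasure (sᶜ.card / 2) 1) (Measurable.lintegral_prod_right' (f := fun p : ℝ × ℝ =>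
          f (p.1 / (p.1 + p.2))) (by fun_prop)), mul_assoc, mul_left_comm]

/-- The sphere of radius `R` carries an invariant probability measure, under which the sum of the
squares of a set of coordinates is beta distributed. -/
theorem exists_invariant_sphere_map_sum_sq [DecidableEq ι] {s : Finset ι} (hs : s.Nonempty)
    (hs' : sᶜ.Nonempty) {R : ℝ} (hR : 0 < R) :
    ∃ σ : Measure (EuclideanSpace ℝ ι), IsProbabilityMeasure σ ∧ (∀ᵐ x ∂σ, ‖x‖ = R) ∧
      (∀ g : EuclideanSpace ℝ ι ≃ₗᵢ[ℝ] EuclideanSpace ℝ ι, σ.map g = σ) ∧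
      σ.map (fun x => ∑ i ∈ s, x i ^ 2) = betaOn (R ^ 2) (s.card / 2) (sᶜ.card / 2) := by
  obtain ⟨c, hc0, hct, hc⟩ := exists_lintegral_sum_sq_div_norm_sq hs hs'
  have hp1 : (0 : ℝ) < s.card / 2 := by have := hs.card_pos; positivity
  have hp2 : (0 : ℝ) < sᶜ.card / 2 := by have := hs'.card_pos; positivity
  have : Nonempty ι := hs.to_type
  have hβ := isProbabilityMeasureBeta hp1 hp2
  set w : EuclideanSpace ℝ ι → ℝ≥0∞ := fun x => ENNReal.ofReal (Real.exp (-‖x‖ ^ 2)) with hw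
  have hwm : Measurable w := by fun_prop
  set γ : Measure (EuclideanSpace ℝ ι) := volume.withDensity w with hγ
  -- Radial projection to the sphere. It sends 0 to 0 because division by zero gives 0, but the
  -- origin is null. It commutes with linear isometries, which preserve both volume and weight.
  set N : EuclideanSpace ℝ ι → EuclideanSpace ℝ ι := fun x => (R / ‖x‖) • x with hN
  have hNm : Measurable N := by fun_prop
  have hγi : ∀ F : EuclideanSpace ℝ ι → ℝ≥0∞, Measurable F → ∫⁻ x, F x ∂γ = ∫⁻ x, F x * w x := by
    intro F hF
    rw [hγ, lintegral_withDensity_eq_lintegral_mul _ hwm hF]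
    simp only [Pi.mul_apply, mul_comm]
  have hγu : γ univ = c := by
    have h := hc (fun _ => 1) measurable_const
    rw [← hγi (fun _ => 1) measurable_const] at h
    simpa using h
  refine ⟨c⁻¹ • γ.map N, ⟨?_⟩, ?_, ?_, ?_⟩
  · rw [Measure.smul_apply, Measure.map_apply hNm MeasurableSet.univ, preimage_univ, hγu,
      smul_eq_mul, ENNReal.inv_mul_cancel hc0 hct]
  · refine Measure.ae_smul_measure ?_ _
    rw [ae_map_iff hNm.aemeasurable (measurableSet_eq_fun measurable_norm measurable_const)]
    have h0 : ∀ᵐ x ∂(volume : Measure (EuclideanSpace ℝ ι)), x ≠ 0 := by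
      simp [ae_iff]
    filter_upwards [(withDensity_absolutelyContinuous _ w).ae_le h0] with x hx
    have := norm_pos_iff.2 hx
    rw [hN, norm_smul, Real.norm_of_nonneg (by positivity)]
    field_simp
  · intro g
    have hgm : Measurable g := g.continuous.measurable
    have hγg : γ.map g = γ := by
      refine Measure.ext_of_lintegral _ fun F hF => ?_
      rw [lintegral_map hF hgm, hγi (fun x => F (g x)) (hF.comp hgm),
        hγi _ hF,
        ← g.measurePreserving.lintegral_comp (f := fun x => F x * w x) (hF.mul hwm)]
      simp [hw]
    rw [Measure.map_smul, Measure.map_map hgm hNm]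
    conv_rhs => rw [← hγg, Measure.map_map hNm hgm]
    congr 2
    funext x
    simp [hN]
  · have hQm : Measurable fun x : EuclideanSpace ℝ ι => ∑ i ∈ s, x i ^ 2 := by fun_prop
    refine Measure.ext_of_lintegral _ fun F hF => ?_
    rw [Measure.map_smul, lintegral_smul_measure, Measure.map_map hQm hNm,
      lintegral_map hF (hQm.comp hNm),
      hγi (fun x => F (((fun x => ∑ i ∈ s, x i ^ 2) ∘ N) x)) (hF.comp (hQm.comp hNm)), betaOn,
      lintegral_map hF (by fun_prop)]
    have h := hc (fun z => F (R ^ 2 * z)) (by fun_prop)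
    have h' : ∀ x : EuclideanSpace ℝ ι, F (((fun x : EuclideanSpace ℝ ι => ∑ i ∈ s, x i ^ 2) ∘ N) x)
        = F (R ^ 2 * ((∑ i ∈ s, x i ^ 2) / ‖x‖ ^ 2)) := by
      intro x
      congr 1
      simp only [Function.comp_apply, hN, PiLp.smul_apply, smul_eq_mul, mul_pow, ← Finset.mul_sum]
      ring
    simp only [h']
    rw [h, smul_eq_mul, ← mul_assoc, ENNReal.inv_mul_cancel hc0 hct, one_mul]

end Sphere

/-! ### Spheres in powers of an inner product space. -/

section Blocks

open Set Module

variable {ι H : Type*} [Fintype ι] [DecidableEq ι] [NormedAddCommGroup H] [InnerProductSpace ℝ H]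
  [FiniteDimensional ℝ H] [MeasurableSpace H] [BorelSpace H] [SecondCountableTopology H]

/-- The sphere of radius `R` in a power of `H` carries an invariant probability measure, under
which the sum of the squared norms of a set of components is beta distributed. -/
theorem exists_invariant_sphere_map_sum_norm_sq [Nontrivial H] {s : Finset ι} (hs : s.Nonempty)
    (hs' : sᶜ.Nonempty) {R : ℝ} (hR : 0 < R) :
    ∃ σ : Measure (PiLp 2 fun _ : ι => H), IsProbabilityMeasure σ ∧ (∀ᵐ x ∂σ, ‖x‖ = R) ∧
      (∀ g : (PiLp 2 fun _ : ι => H) ≃ₗᵢ[ℝ] (PiLp 2 fun _ : ι => H), σ.map g = σ) ∧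
      σ.map (fun x => ∑ i ∈ s, ‖x i‖ ^ 2) =
        betaOn (R ^ 2) (finrank ℝ H * s.card / 2) (finrank ℝ H * sᶜ.card / 2) := by
  -- An orthonormal basis of `H` turns each component into a block of real coordinates, which
  -- multiplies the number of coordinates by the dimension of `H`.
  set J : EuclideanSpace ℝ (Σ _ : ι, Fin (finrank ℝ H)) ≃ₗᵢ[ℝ] (PiLp 2 fun _ : ι => H) :=
    (LinearIsometryEquiv.piLpCurry ℝ 2 (fun (_ : ι) (_ : Fin (finrank ℝ H)) => ℝ)).trans
      (LinearIsometryEquiv.piLpCongrRight 2 fun _ => (stdOrthonormalBasis ℝ H).repr.symm) with hJ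
  have hd : 0 < finrank ℝ H := finrank_pos
  set t : Finset (Σ _ : ι, Fin (finrank ℝ H)) := s.sigma fun _ => Finset.univ with ht
  have htc : tᶜ = sᶜ.sigma fun _ => Finset.univ := by
    ext x
    simp [ht]
  have htn : t.Nonempty := by
    obtain ⟨i, hi⟩ := hs
    exact ⟨⟨i, ⟨0, hd⟩⟩, by simp [ht, hi]⟩
  have htn' : tᶜ.Nonempty := by
    obtain ⟨i, hi⟩ := hs'
    exact ⟨⟨i, ⟨0, hd⟩⟩, by simpa [ht] using hi⟩
  obtain ⟨σ, hσp, hσR, hσ, hσt⟩ := exists_invariant_sphere_map_sum_sq htn htn' hR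
  have hJm : Measurable J := J.continuous.measurable
  have hJsm : Measurable J.symm := J.symm.continuous.measurable
  have hnorm : ∀ x : EuclideanSpace ℝ (Σ _ : ι, Fin (finrank ℝ H)), ∀ i,
      ‖J x i‖ ^ 2 = ∑ j, x ⟨i, j⟩ ^ 2 := by
    intro x i
    have : J x i = (stdOrthonormalBasis ℝ H).repr.symm (WithLp.toLp 2 fun j => x ⟨i, j⟩) := rfl
    rw [this, LinearIsometryEquiv.norm_map, EuclideanSpace.real_norm_sq_eq]
  refine ⟨σ.map J, Measure.isProbabilityMeasure_map hJm.aemeasurable, ?_, fun g => ?_, ?_⟩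
  · rw [ae_map_iff hJm.aemeasurable (measurableSet_eq_fun measurable_norm measurable_const)]
    simpa using hσR
  · have hg := hσ ((J.trans g).trans J.symm)
    have hgm : Measurable g := g.continuous.measurable
    conv_rhs => rw [← hg]
    rw [Measure.map_map hgm hJm, Measure.map_map hJm (LinearIsometryEquiv.continuous _).measurable]
    congr 1
    funext x
    simp
  · rw [Measure.map_map (by fun_prop) hJm]
    have hfun : (fun x : PiLp 2 fun _ : ι => H => ∑ i ∈ s, ‖x i‖ ^ 2) ∘ J =
        fun x => ∑ k ∈ t, x k ^ 2 := by
      funext x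
      simp only [Function.comp_apply, hnorm, ht, Finset.sum_sigma]
    rw [hfun, hσt, htc, ht, Finset.card_sigma, Finset.card_sigma]
    simp [mul_comm]

/-- Under an invariant probability measure on the sphere of radius `R` in a power of `H`, the sum
of the squared norms of a set of components is beta distributed. -/
theorem map_sum_norm_sq_of_invariant_of_sphere [Nontrivial H] {s : Finset ι} (hs : s.Nonempty)
    (hs' : sᶜ.Nonempty) {R : ℝ} (hR : 0 < R) {μ : Measure (PiLp 2 fun _ : ι => H)}
    [IsProbabilityMeasure μ] (hμR : ∀ᵐ x ∂μ, ‖x‖ = R)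
    (hμ : ∀ g : (PiLp 2 fun _ : ι => H) ≃ₗᵢ[ℝ] (PiLp 2 fun _ : ι => H), μ.map g = μ) :
    μ.map (fun x => ∑ i ∈ s, ‖x i‖ ^ 2) =
      betaOn (R ^ 2) (finrank ℝ H * s.card / 2) (finrank ℝ H * sᶜ.card / 2) := by
  obtain ⟨σ, _, hσR, hσ, hσs⟩ := exists_invariant_sphere_map_sum_norm_sq (H := H) hs hs' hR
  rw [eq_of_invariant_of_sphere hR hμR hσR hμ hσ, hσs]

end Blocks

/-! ### Normalized Hausdorff measure. -/

section Hausdorff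

open Set Module

/-- Normalized Hausdorff measure on a set which is preserved by an isometry is invariant under this
isometry. -/
theorem map_cond_hausdorffMeasure_of_preimage_eq {X : Type*} [EMetricSpace X] [MeasurableSpace X]
    [BorelSpace X] {m : ℝ} (e : X ≃ᵢ X) {M : Set X} (hM : MeasurableSet M) (he : e ⁻¹' M = M) :
    (cond (Measure.hausdorffMeasure m) M).map e = cond (Measure.hausdorffMeasure m) M := by
  rw [ProbabilityTheory.cond, Measure.map_smul]
  conv_lhs => rw [← he]
  rw [← Measure.restrict_map e.continuous.measurable hM, e.map_hausdorffMeasure, he]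

/-- Normalized Hausdorff measure is transported by isometric embeddings. -/
theorem cond_hausdorffMeasure_image {X Y : Type*} [MetricSpace X] [CompleteSpace X]
    [MeasurableSpace X] [BorelSpace X] [MetricSpace Y] [MeasurableSpace Y] [BorelSpace Y] {m : ℝ}
    (hm : 0 ≤ m) {Ψ : X → Y} (hΨ : Isometry Ψ) {M : Set X} (hM : MeasurableSet M) :
    cond (Measure.hausdorffMeasure m) (Ψ '' M) =
      (cond (Measure.hausdorffMeasure m) M).map Ψ := by
  have hemb : MeasurableEmbedding Ψ := hΨ.isClosedEmbedding.measurableEmbedding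
  rw [ProbabilityTheory.cond, ProbabilityTheory.cond,
    hΨ.hausdorffMeasure_image (Or.inl hm), Measure.map_smul]
  congr 1
  have h := Measure.restrict_map (μ := (Measure.hausdorffMeasure m : Measure X))
    hemb.measurable (hemb.measurableSet_image.2 hM)
  rw [preimage_image_eq _ hΨ.injective, hΨ.map_hausdorffMeasure (Or.inl hm),
    Measure.restrict_restrict (hemb.measurableSet_image.2 hM),
    inter_eq_self_of_subset_left (image_subset_range _ _)] at h
  exact h

/-- Both bounds matter: `cond μ M` degenerates to the zero measure if the mass of `M` is 0 or ∞. -/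
theorem isProbabilityMeasure_cond {Ω : Type*} [MeasurableSpace Ω] {μ : Measure Ω} {M : Set Ω}
    (h : 0 < μ M ∧ μ M < ∞) : IsProbabilityMeasure (cond μ M) :=
  ⟨by
    rw [ProbabilityTheory.cond, Measure.smul_apply, Measure.restrict_apply_univ, smul_eq_mul,
      ENNReal.inv_mul_cancel h.1.ne' h.2.ne]⟩

theorem ae_cond_mem {Ω : Type*} [MeasurableSpace Ω] {μ : Measure Ω} {M : Set Ω}
    (hM : MeasurableSet M) : ∀ᵐ x ∂cond μ M, x ∈ M :=
  Measure.ae_smul_measure (ae_restrict_mem hM) _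

/-- A sphere of positive radius has positive finite Hausdorff measure in its dimension. -/
theorem hausdorffMeasure_sphere_pos_and_lt_top {V : Type*} [NormedAddCommGroup V]
    [InnerProductSpace ℝ V] [FiniteDimensional ℝ V] [Nontrivial V] [MeasurableSpace V]
    [BorelSpace V] {R m : ℝ} (hR : 0 < R) (hm : m = finrank ℝ V - 1) :
    0 < (Measure.hausdorffMeasure m : Measure V) (Metric.sphere 0 R) ∧
      (Measure.hausdorffMeasure m : Measure V) (Metric.sphere 0 R) < ∞ := by
  have : ProperSpace V := FiniteDimensional.proper ℝ V
  have hS : Metric.sphere (0 : V) R = (fun x : V => ‖x‖ ^ 2) ⁻¹' {R ^ 2} := by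
    ext x
    simp [pow_left_inj₀ (norm_nonneg x) hR.le]
  rw [hS]
  refine hausdorffMeasure_levelSet_pos_and_lt_top (f' := fun x => 2 • innerSL ℝ x) ?_ ?_
    (fun x _ => hasStrictFDerivAt_norm_sq x) (fun x hx y => ?_) (by simpa using hm)
  · rw [← hS]
    exact isCompact_sphere _ _
  · rw [← hS]
    exact NormedSpace.sphere_nonempty.2 hR.le
  · have hx : ‖x‖ ^ 2 = R ^ 2 := hx
    -- The derivative at x is 2⟪x, ·⟫, which takes the value 2R² at x itself.
    refine ⟨(y / (2 * R ^ 2)) • x, ?_⟩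
    simp only [smul_apply, innerSL_apply_apply, inner_smul_right,
      real_inner_self_eq_norm_sq, hx]
    simp only [nsmul_eq_mul, Nat.cast_ofNat]
    field_simp

/-- Under the normalized volume of the sphere of radius `R` in a power of `H`, the sum of the
squared norms of a set of components is beta distributed. -/
theorem map_sum_norm_sq_cond_sphere {ι H : Type*} [Fintype ι] [DecidableEq ι]
    [NormedAddCommGroup H] [InnerProductSpace ℝ H] [FiniteDimensional ℝ H] [MeasurableSpace H]
    [BorelSpace H] [SecondCountableTopology H] [Nontrivial H] {s : Finset ι} (hs : s.Nonempty)
    (hs' : sᶜ.Nonempty) {R m : ℝ} (hR : 0 < R) (hm : m = Fintype.card ι * finrank ℝ H - 1) :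
    (cond (Measure.hausdorffMeasure m)
        (Metric.sphere (0 : PiLp 2 fun _ : ι => H) R)).map (fun x => ∑ i ∈ s, ‖x i‖ ^ 2) =
      betaOn (R ^ 2) (finrank ℝ H * s.card / 2) (finrank ℝ H * sᶜ.card / 2) := by
  have : Nonempty ι := hs.to_type
  have hdim : finrank ℝ (PiLp 2 fun _ : ι => H) = Fintype.card ι * finrank ℝ H := by
    rw [(WithLp.linearEquiv 2 ℝ (ι → H)).finrank_eq, finrank_pi_fintype]
    simp
  have hpos := hausdorffMeasure_sphere_pos_and_lt_top (V := PiLp 2 fun _ : ι => H) (m := m) hR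
    (by rw [hm, hdim]; push_cast; ring)
  have := isProbabilityMeasure_cond hpos
  have hmeas : MeasurableSet (Metric.sphere (0 : PiLp 2 fun _ : ι => H) R) :=
    Metric.isClosed_sphere.measurableSet
  refine map_sum_norm_sq_of_invariant_of_sphere hs hs' hR ?_ fun g => ?_
  · filter_upwards [ae_cond_mem hmeas] with x hx
    simpa using hx
  · refine map_cond_hausdorffMeasure_of_preimage_eq g.toIsometryEquiv hmeas ?_
    ext x
    simp

end Hausdorff

/-! ### Stiefel manifolds and random orthonormal frames. -/

section Frames

open Set Module

/-- Linear isometries act transitively on orthonormal families. -/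
theorem exists_linearIsometryEquiv_of_orthonormal {𝕜 E κ : Type*} [RCLike 𝕜]
    [NormedAddCommGroup E] [InnerProductSpace 𝕜 E] [FiniteDimensional 𝕜 E] [Fintype κ]
    {v w : κ → E} (hv : Orthonormal 𝕜 v) (hw : Orthonormal 𝕜 w) :
    ∃ g : E ≃ₗᵢ[𝕜] E, ∀ k, g (v k) = w k := by
  have hcard : Fintype.card κ ≤ Fintype.card (Fin (finrank 𝕜 E)) := by
    simpa using hv.linearIndependent.fintype_card_le_finrank
  obtain ⟨e⟩ := Function.Embedding.nonempty_of_card_le hcard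
  -- Each family is completed to an orthonormal basis that carries it at the same positions `e k`;
  -- the isometry then matches the two bases. The default value 0 of `Function.extend` off the range
  -- of `e` plays no role.
  have hext : ∀ u : κ → E, Orthonormal 𝕜 u →
      ∃ b : OrthonormalBasis (Fin (finrank 𝕜 E)) 𝕜 E, ∀ k, b (e k) = u k := by
    intro u hu
    have ho : Orthonormal 𝕜 ((range e).domRestrict (Function.extend e u 0)) := by
      have : (range e).domRestrict (Function.extend e u 0) =
          u ∘ (Equiv.ofInjective e e.injective).symm := by
        funext ⟨_, k, rfl⟩
        simp [Set.domRestrict, e.injective.extend_apply]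
      rw [this]
      exact hu.comp _ (Equiv.injective _)
    obtain ⟨b, hb⟩ := ho.exists_orthonormalBasis_extension_of_card_eq (by simp)
    exact ⟨b, fun k => by rw [hb _ (mem_range_self k), e.injective.extend_apply]⟩
  obtain ⟨b, hb⟩ := hext v hv
  obtain ⟨b', hb'⟩ := hext w hw
  refine ⟨b.equiv b' (Equiv.refl _), fun k => ?_⟩
  rw [← hb, ← hb']
  simp

/-- The law of `∑ j, ‖⟪p j, w⟫‖²` for a random orthonormal family `p` and fixed unit vector `w`
agrees with its law for a fixed orthonormal family `p` and random unit vector `w`. -/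
theorem map_sum_norm_inner_sq_eq {𝕜 E κ : Type*} [RCLike 𝕜] [NormedAddCommGroup E]
    [InnerProductSpace 𝕜 E] [FiniteDimensional 𝕜 E] [Fintype κ] [MeasurableSpace E] [BorelSpace E]
    [SecondCountableTopology E] {μ : Measure (PiLp 2 fun _ : κ => E)} {σ : Measure E}
    [IsProbabilityMeasure μ] [IsProbabilityMeasure σ]
    (hμo : ∀ᵐ p ∂μ, Orthonormal 𝕜 fun k => p k) (hσ1 : ∀ᵐ w ∂σ, ‖w‖ = 1)
    (hμ : ∀ g : E ≃ₗᵢ[𝕜] E, μ.map (LinearIsometryEquiv.piLpCongrRight 2 fun _ : κ => g) = μ)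
    (hσ : ∀ g : E ≃ₗᵢ[𝕜] E, σ.map g = σ) {p₀ : PiLp 2 fun _ : κ => E}
    (hp₀ : Orthonormal 𝕜 fun k => p₀ k) {w₀ : E} (hw₀ : ‖w₀‖ = 1) :
    μ.map (fun p => ∑ k, ‖inner 𝕜 (p k) w₀‖ ^ 2) =
      σ.map (fun w => ∑ k, ‖inner 𝕜 (p₀ k) w‖ ^ 2) := by
  set Φ : (PiLp 2 fun _ : κ => E) → E → ℝ := fun p w => ∑ k, ‖inner 𝕜 (p k) w‖ ^ 2 with hΦ
  have hΦc : Continuous (Function.uncurry Φ) := by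
    simp only [hΦ, Function.uncurry_def]
    fun_prop
  refine map_eq_map_of_forall_map_eq (Φ := Φ) (M := {p | Orthonormal 𝕜 fun k => p k})
    (S := {w | ‖w‖ = 1}) hΦc.measurable hμo hσ1 (fun p hp p' hp' => ?_) (fun w hw w' hw' => ?_)
    hp₀ hw₀
  · obtain ⟨g, hg⟩ := exists_linearIsometryEquiv_of_orthonormal hp hp'
    have hfun : Φ p = Φ p' ∘ g := by
      funext w
      simp only [hΦ, Function.comp_apply, ← hg, g.inner_map_map]
    have hm : Measurable (Φ p') := (hΦc.comp (Continuous.prodMk_right p')).measurable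
    rw [hfun, ← Measure.map_map hm g.continuous.measurable, hσ g]
  -- A unit vector is a one-element orthonormal family, so transitivity applies again. Now the
  -- isometry acts diagonally on the frame.
  · have horth : ∀ w : E, ‖w‖ = 1 → Orthonormal 𝕜 fun _ : Unit => w := fun w hw =>
      ⟨fun _ => hw, fun i j hij => (hij (Subsingleton.elim i j)).elim⟩
    obtain ⟨g, hg⟩ := exists_linearIsometryEquiv_of_orthonormal (horth w hw) (horth w' hw')
    have hfun : (Φ · w) = (Φ · w') ∘ LinearIsometryEquiv.piLpCongrRight 2 fun _ : κ => g := by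
      funext p
      simp only [hΦ, Function.comp_apply, ← hg (), LinearIsometryEquiv.piLpCongrRight_apply,
        g.inner_map_map]
    have hm : Measurable (Φ · w') := (hΦc.comp (Continuous.prodMk_left w')).measurable
    rw [hfun, ← Measure.map_map hm (LinearIsometryEquiv.continuous _).measurable, hμ g]

/-- Pairs of orthonormal vectors, in the `ℓ²` product. -/
def orthonormalPairs (𝕜 : Type*) [RCLike 𝕜] (E : Type*) [NormedAddCommGroup E]
    [InnerProductSpace 𝕜 E] : Set (PiLp 2 fun _ : Fin 2 => E) :=
  {p | Orthonormal 𝕜 fun k => p k}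

variable {𝕜 E : Type*} [RCLike 𝕜] [NormedAddCommGroup E] [InnerProductSpace 𝕜 E]

/-- Taking real parts in the norm equations drops the redundant imaginary parts, leaving 2 + dim 𝕜
real equations, as needed for the level set to be regular. -/
theorem mem_orthonormalPairs {p : PiLp 2 fun _ : Fin 2 => E} :
    p ∈ orthonormalPairs 𝕜 E ↔ RCLike.re (inner 𝕜 (p 0) (p 0)) = 1 ∧
      RCLike.re (inner 𝕜 (p 1) (p 1)) = 1 ∧ inner 𝕜 (p 0) (p 1) = 0 := by
  have h1 : ∀ x : E, RCLike.re (inner 𝕜 x x) = 1 ↔ ‖x‖ = 1 := fun x => by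
    rw [inner_self_eq_norm_sq, pow_eq_one_iff_of_nonneg (norm_nonneg x) two_ne_zero]
  rw [h1, h1]
  constructor
  · intro h
    exact ⟨h.1 0, h.1 1, h.2 zero_ne_one⟩
  · rintro ⟨h0, h1, h2⟩
    refine ⟨Fin.forall_fin_two.2 ⟨h0, h1⟩, ?_⟩
    intro i j hij
    fin_cases i <;> fin_cases j
    · exact (hij rfl).elim
    · exact h2
    · exact inner_eq_zero_symm.1 h2
    · exact (hij rfl).elim

theorem isClosed_orthonormalPairs : IsClosed (orthonormalPairs 𝕜 E) := by
  have : orthonormalPairs 𝕜 E = {p | RCLike.re (inner 𝕜 (p 0) (p 0)) = 1} ∩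
      ({p | RCLike.re (inner 𝕜 (p 1) (p 1)) = 1} ∩ {p | inner 𝕜 (p 0) (p 1) = 0}) := by
    ext p
    exact mem_orthonormalPairs
  rw [this]
  exact (isClosed_eq (by fun_prop) continuous_const).inter
    ((isClosed_eq (by fun_prop) continuous_const).inter
      (isClosed_eq (by fun_prop) continuous_const))

theorem measurableSet_orthonormalPairs [MeasurableSpace E] [BorelSpace E]
    [SecondCountableTopology E] : MeasurableSet (orthonormalPairs 𝕜 E) :=
  isClosed_orthonormalPairs.measurableSet

/-- The Stiefel manifold of orthonormal pairs has positive finite Hausdorff measure in its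
dimension. -/
theorem hausdorffMeasure_orthonormalPairs_pos_and_lt_top [NormedSpace ℝ E] [IsScalarTower ℝ 𝕜 E]
    [FiniteDimensional ℝ E] [FiniteDimensional 𝕜 E] [MeasurableSpace E] [BorelSpace E]
    [SecondCountableTopology E] (hE : 2 ≤ finrank 𝕜 E) {m : ℝ}
    (hm : m = 2 * finrank ℝ E - (2 + finrank ℝ 𝕜)) :
    0 < (Measure.hausdorffMeasure m : Measure (PiLp 2 fun _ : Fin 2 => E)) (orthonormalPairs 𝕜 E) ∧
      (Measure.hausdorffMeasure m : Measure (PiLp 2 fun _ : Fin 2 => E)) (orthonormalPairs 𝕜 E)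
        < ∞ := by
  have : ProperSpace (PiLp 2 fun _ : Fin 2 => E) := FiniteDimensional.proper ℝ _
  set f : (PiLp 2 fun _ : Fin 2 => E) → ℝ × ℝ × 𝕜 := fun p =>
    (RCLike.re (inner 𝕜 (p 0) (p 0)), RCLike.re (inner 𝕜 (p 1) (p 1)), inner 𝕜 (p 0) (p 1)) with hf
  have hM : orthonormalPairs 𝕜 E = f ⁻¹' {(1, 1, 0)} := by
    ext p
    rw [mem_orthonormalPairs]
    simp [hf]
  set π : Fin 2 → (PiLp 2 fun _ : Fin 2 => E) →L[ℝ] E := fun k =>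
    PiLp.proj 2 (fun _ : Fin 2 => E) k with hπ
  set B : Fin 2 → Fin 2 → (PiLp 2 fun _ : Fin 2 => E) → (PiLp 2 fun _ : Fin 2 => E) →L[ℝ] 𝕜 :=
    fun j k p => fderivInnerCLM 𝕜 (p j, p k) ∘SL (π j).prod (π k) with hB
  have hBd : ∀ j k p, HasStrictFDerivAt (fun p : PiLp 2 fun _ : Fin 2 => E =>
      inner 𝕜 (p j) (p k)) (B j k p) p := fun j k p =>
    HasStrictFDerivAt.inner 𝕜 (π j).hasStrictFDerivAt (π k).hasStrictFDerivAt
  have hBa : ∀ j k p q, B j k p q = inner 𝕜 (p j) (q k) + inner 𝕜 (q j) (p k) := fun j k p q => by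
    simp [hB, hπ, fderivInnerCLM_apply]
  rw [hM]
  refine hausdorffMeasure_levelSet_pos_and_lt_top (f' := fun p =>
    (RCLike.reCLM ∘SL B 0 0 p).prod ((RCLike.reCLM ∘SL B 1 1 p).prod (B 0 1 p)))
    ?_ ?_ (fun p _ => ?_) (fun p hp => ?_) ?_
  · rw [← hM]
    refine Metric.isCompact_of_isClosed_isBounded isClosed_orthonormalPairs ?_
    refine (Metric.isBounded_closedBall (x := (0 : PiLp 2 fun _ : Fin 2 => E)) (r := √2)).subset ?_
    intro p hp
    have hp : Orthonormal 𝕜 fun k => p k := hp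
    rw [mem_closedBall_zero_iff, PiLp.norm_eq_of_L2]
    simp [show ∀ k, ‖p k‖ = 1 from hp.1]
  · rw [← hM]
    have b := stdOrthonormalBasis 𝕜 E
    refine ⟨WithLp.toLp 2 fun k => b (Fin.castLE hE k), ?_⟩
    exact b.orthonormal.comp _ (Fin.castLE_injective hE)
  · exact (RCLike.reCLM.hasStrictFDerivAt.comp p (hBd 0 0 p)).prodMk
      ((RCLike.reCLM.hasStrictFDerivAt.comp p (hBd 1 1 p)).prodMk (hBd 0 1 p))
  · rw [← hM] at hp
    have hp : Orthonormal 𝕜 fun k => p k := hp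
    have h0 : ‖p 0‖ = 1 := hp.1 0
    have h1 : ‖p 1‖ = 1 := hp.1 1
    have h01 : inner 𝕜 (p 0) (p 1) = 0 := hp.2 zero_ne_one
    have h10 : inner 𝕜 (p 1) (p 0) = 0 := hp.2 one_ne_zero
    rintro ⟨a, b, c⟩
    -- Targets are halved because the derivative of ‖p k‖² is 2 Re⟪p k, ·⟫. Scaling p 0 and p 1
    -- reaches the two norm equations, and adding c • p 0 to the second vector reaches the inner
    -- product without disturbing them.
    obtain ⟨a, rfl⟩ : ∃ a', 2 * a' = a := ⟨a / 2, by ring⟩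
    obtain ⟨b, rfl⟩ : ∃ b', 2 * b' = b := ⟨b / 2, by ring⟩
    obtain ⟨α, hα⟩ : ∃ α : 𝕜, RCLike.re α = a := ⟨a, by simp⟩
    obtain ⟨β, hβ⟩ : ∃ β : 𝕜, RCLike.re β = b := ⟨b, by simp⟩
    refine ⟨WithLp.toLp 2 ![α • p 0, β • p 1 + c • p 0], ?_⟩
    simp only [ContinuousLinearMap.prod_apply, ContinuousLinearMap.comp_apply, hBa]
    simp [inner_add_left, inner_add_right, inner_smul_left, inner_smul_right, h0, h1, h01,
      h10, hα, hβ, two_mul]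
  · have hdim : finrank ℝ (PiLp 2 fun _ : Fin 2 => E) = 2 * finrank ℝ E := by
      rw [(WithLp.linearEquiv 2 ℝ (Fin 2 → E)).finrank_eq, finrank_pi_fintype]
      simp
    rw [hdim, finrank_prod, finrank_prod, hm]
    simp
    ring

/-- Under the normalized volume of the Stiefel manifold `V₂(𝕜ⁿ)`, the squared norm of the `i`-th
row is beta distributed. -/
theorem map_sum_norm_sq_cond_orthonormalPairs {n : ℕ} (hn : 3 ≤ n)
    (i : Fin n) {m : ℝ} (hm : m = 2 * (n * finrank ℝ 𝕜) - (2 + finrank ℝ 𝕜)) :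
    (cond (Measure.hausdorffMeasure m) (orthonormalPairs 𝕜 (EuclideanSpace 𝕜 (Fin n)))).map
        (fun p => ‖p 0 i‖ ^ 2 + ‖p 1 i‖ ^ 2) =
      betaOn 1 (finrank ℝ 𝕜) (finrank ℝ 𝕜 * (n - 2) / 2) := by
  have hdimR : finrank ℝ (EuclideanSpace 𝕜 (Fin n)) = n * finrank ℝ 𝕜 := by
    rw [(WithLp.linearEquiv 2 ℝ (Fin n → 𝕜)).finrank_eq, finrank_pi_fintype]
    simp
  have hpos := hausdorffMeasure_orthonormalPairs_pos_and_lt_top (𝕜 := 𝕜)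
    (E := EuclideanSpace 𝕜 (Fin n)) (m := m) (by simp; omega) (by rw [hm, hdimR]; push_cast; ring)
  have hμp := isProbabilityMeasure_cond hpos
  have hmeas : MeasurableSet (orthonormalPairs 𝕜 (EuclideanSpace 𝕜 (Fin n))) :=
    measurableSet_orthonormalPairs
  let j₀ : Fin n := ⟨0, by omega⟩
  let j₁ : Fin n := ⟨1, by omega⟩
  have hj : j₀ ≠ j₁ := by simp [j₀, j₁]
  have hcard : ({j₀, j₁} : Finset (Fin n)).card = 2 := Finset.card_pair hj
  have hcard' : ({j₀, j₁} : Finset (Fin n))ᶜ.card = n - 2 := by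
    rw [Finset.card_compl, hcard, Fintype.card_fin]
  obtain ⟨σ, hσp, hσ1, hσ, hσs⟩ := exists_invariant_sphere_map_sum_norm_sq (ι := Fin n) (H := 𝕜)
    (s := {j₀, j₁}) (by simp) (by rw [← Finset.card_pos, hcard']; omega) one_pos
  have hbasis : Orthonormal 𝕜 fun j : Fin n =>
      (EuclideanSpace.single j 1 : EuclideanSpace 𝕜 (Fin n)) :=
    EuclideanSpace.orthonormal_single
  set p₀ : PiLp 2 fun _ : Fin 2 => EuclideanSpace 𝕜 (Fin n) :=
    WithLp.toLp 2 fun k => EuclideanSpace.single (![j₀, j₁] k) 1 with hp₀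
  have hp₀o : Orthonormal 𝕜 fun k => p₀ k := by
    refine hbasis.comp ![j₀, j₁] ?_
    intro a b hab
    fin_cases a <;> fin_cases b <;> simp_all [eq_comm]
  -- The fixed vector is the ith basis vector and the fixed frame consists of the first two basis
  -- vectors; for a random unit vector w this leaves ‖w 0‖² + ‖w 1‖².
  have h := map_sum_norm_inner_sq_eq (𝕜 := 𝕜) (E := EuclideanSpace 𝕜 (Fin n))
    (κ := Fin 2)
    (μ := cond (Measure.hausdorffMeasure m) (orthonormalPairs 𝕜 (EuclideanSpace 𝕜 (Fin n))))
    (σ := σ) (p₀ := p₀)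
    (w₀ := EuclideanSpace.single i 1) (ae_cond_mem hmeas) hσ1 (fun g => ?_) (fun g => ?_) hp₀o
    (by simp)
  · have hl : (fun p : PiLp 2 fun _ : Fin 2 => EuclideanSpace 𝕜 (Fin n) =>
        ∑ k, ‖inner 𝕜 (p k) (EuclideanSpace.single i 1 : EuclideanSpace 𝕜 (Fin n))‖ ^ 2) =
        fun p => ‖p 0 i‖ ^ 2 + ‖p 1 i‖ ^ 2 := by
      funext p
      simp [Fin.sum_univ_two, EuclideanSpace.inner_single_right]
    have hr : (fun w : EuclideanSpace 𝕜 (Fin n) => ∑ k, ‖inner 𝕜 (p₀ k) w‖ ^ 2) =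
        fun w => ∑ j ∈ {j₀, j₁}, ‖w j‖ ^ 2 := by
      funext w
      simp [hp₀, Fin.sum_univ_two, EuclideanSpace.inner_single_left, Finset.sum_pair hj]
    rw [hl, hr] at h
    rw [h, hσs, hcard, hcard', Nat.cast_sub (by omega)]
    norm_num
  · refine map_cond_hausdorffMeasure_of_preimage_eq
      (LinearIsometryEquiv.piLpCongrRight 2 fun _ : Fin 2 => g).toIsometryEquiv hmeas ?_
    ext p
    exact g.toLinearIsometry.orthonormal_comp_iff
  · exact hσ { g.toLinearEquiv.restrictScalars ℝ with norm_map' := g.norm_map }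

end Frames

/-! ### The Hopf map in coordinates. -/

section Hopf

theorem qi_re : qi.re = 0 := rfl

theorem qi_imI : qi.imI = 1 := rfl

theorem qi_imJ : qi.imJ = 0 := rfl

theorem qi_imK : qi.imK = 0 := rfl

theorem hopf_zero (q : ℍ[ℝ]) :
    hopf q 0 = q.re ^ 2 + q.imI ^ 2 - q.imJ ^ 2 - q.imK ^ 2 := by
  simp [hopf, qi_re, qi_imI, qi_imJ, qi_imK]
  ring

theorem hopf_one (q : ℍ[ℝ]) : hopf q 1 = 2 * (q.imI * q.imJ - q.re * q.imK) := by
  simp [hopf, qi_re, qi_imI, qi_imJ, qi_imK]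
  ring

theorem hopf_two (q : ℍ[ℝ]) : hopf q 2 = 2 * (q.re * q.imJ + q.imI * q.imK) := by
  simp [hopf, qi_re, qi_imI, qi_imJ, qi_imK]
  ring

theorem norm_sq_quaternion (q : ℍ[ℝ]) :
    ‖q‖ ^ 2 = q.re ^ 2 + q.imI ^ 2 + q.imJ ^ 2 + q.imK ^ 2 := by
  rw [sq, ← Quaternion.normSq_eq_norm_mul_self, Quaternion.normSq_def']

/-- In coordinates this is a four-square identity. It converts edgelengths into squared norms
upstairs. -/
theorem norm_hopf (q : ℍ[ℝ]) : ‖hopf q‖ = ‖q‖ ^ 2 := by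
  refine (sq_eq_sq₀ (norm_nonneg _) (by positivity)).1 ?_
  rw [EuclideanSpace.real_norm_sq_eq, Fin.sum_univ_three, hopf_zero, hopf_one, hopf_two,
    norm_sq_quaternion]
  ring

theorem continuous_hopf : Continuous hopf := by
  have hre : Continuous fun q : ℍ[ℝ] => q.re := Quaternion.continuous_re
  have hI : Continuous fun q : ℍ[ℝ] => q.imI := Quaternion.continuous_imI
  have hJ : Continuous fun q : ℍ[ℝ] => q.imJ := Quaternion.continuous_imJ
  have hK : Continuous fun q : ℍ[ℝ] => q.imK := Quaternion.continuous_imK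
  have h : hopf = fun q => WithLp.toLp 2 ![hopf q 0, hopf q 1, hopf q 2] := by
    funext q
    ext k
    fin_cases k <;> rfl
  rw [h]
  simp only [hopf_zero, hopf_one, hopf_two]
  refine (PiLp.continuous_toLp 2 _).comp (continuous_pi fun k => ?_)
  fin_cases k <;> simp <;> fun_prop

theorem continuous_hopfMap {n : ℕ} : Continuous (hopfMap (n := n)) :=
  continuous_pi fun k => continuous_hopf.comp (PiLp.continuous_apply 2 _ k)

/-- The conjugate of 𝐢q is -q̄𝐢, and -𝐢𝐢𝐢 = 𝐢. Hence `A` and 𝐢`A` have the same polygons as images.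
-/
theorem hopf_qi_mul (q : ℍ[ℝ]) : hopf (qi * q) = hopf q := by
  ext k
  fin_cases k
  · simp only [Fin.zero_eta, hopf_zero]
    simp [qi_re, qi_imI, qi_imJ, qi_imK]
    ring
  · simp only [Fin.mk_one, hopf_one]
    simp [qi_re, qi_imI, qi_imJ, qi_imK]
    ring
  · simp only [Fin.reduceFinMk, hopf_two]
    simp [qi_re, qi_imI, qi_imJ, qi_imK]
    ring

theorem norm_qi : ‖qi‖ = 1 := by
  refine (sq_eq_sq₀ (norm_nonneg _) zero_le_one).1 ?_
  rw [norm_sq_quaternion]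
  simp [qi_re, qi_imI, qi_imJ, qi_imK]

theorem qi_mul_qi : qi * qi = -1 := by
  ext <;> simp [qi_re, qi_imI, qi_imJ, qi_imK]

/-- Left multiplication of every coordinate by `𝐢`, as an isometry of `ℍⁿ`. -/
noncomputable def qiMul (n : ℕ) : QSpace n ≃ᵢ QSpace n :=
  (LinearIsometryEquiv.piLpCongrRight 2 fun _ : Fin n =>
    ({ toFun := fun q => qi * q
       invFun := fun q => -(qi * q)
       map_add' := fun q r => mul_add _ _ _
       map_smul' := fun c q => by simp
       left_inv := fun q => by
        beta_reduce
        rw [← mul_assoc, qi_mul_qi]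
        simp
       right_inv := fun q => by
        beta_reduce
        rw [mul_neg, ← mul_assoc, qi_mul_qi]
        simp
       norm_map' := fun q => by
        change ‖qi * q‖ = ‖q‖
        rw [norm_mul, norm_qi, one_mul] } : ℍ[ℝ] ≃ₗᵢ[ℝ] ℍ[ℝ])).toIsometryEquiv

theorem qiMul_apply {n : ℕ} (q : QSpace n) : qiMul n q = WithLp.toLp 2 fun k => qi * q k := rfl

theorem hopfMap_qiMul {n : ℕ} (q : QSpace n) : hopfMap (qiMul n q) = hopfMap q :=
  funext fun k => hopf_qi_mul (q k)

theorem sum_norm_hopfMap {n : ℕ} (q : QSpace n) : ∑ k, ‖hopfMap q k‖ = ‖q‖ ^ 2 := by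
  rw [PiLp.norm_sq_eq_of_L2]
  exact Finset.sum_congr rfl fun k _ => norm_hopf _

end Hopf

/-! ### From polygon spaces to the model spaces. -/

section Transfer

open Set

theorem measurableSet_arm (d n : ℕ) : MeasurableSet (Arm d n) :=
  (isClosed_eq (by fun_prop) continuous_const).measurableSet

theorem measurableSet_pol (d n : ℕ) : MeasurableSet (Pol d n) :=
  ((isClosed_eq (by fun_prop) continuous_const).inter
    (isClosed_eq (by fun_prop) continuous_const)).measurableSet

theorem norm_planeToSpace {n : ℕ} (e : Fin n → Vec 2) (k : Fin n) : ‖planeToSpace e k‖ = ‖e k‖ := by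
  refine (sq_eq_sq₀ (norm_nonneg _) (norm_nonneg _)).1 ?_
  rw [EuclideanSpace.real_norm_sq_eq, EuclideanSpace.real_norm_sq_eq]
  simp [planeToSpace, Fin.sum_univ_three, Fin.sum_univ_two]

/-- Forgetting the middle coordinate is a continuous left inverse. The embedding property is what
gives `Measure.comap` in the symmetric measures its intended value. -/
theorem measurableEmbedding_planeToSpace {n : ℕ} :
    MeasurableEmbedding (planeToSpace (n := n)) := by
  have h1 : Continuous (planeToSpace (n := n)) := by
    refine continuous_pi fun k => (PiLp.continuous_toLp 2 _).comp (continuous_pi fun j => ?_)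
    fin_cases j <;> simp <;> fun_prop
  have h2 : Continuous fun e : Fin n → Vec 3 => fun k => (!₂[e k 0, e k 2] : Vec 2) := by
    refine continuous_pi fun k => (PiLp.continuous_toLp 2 _).comp (continuous_pi fun j => ?_)
    fin_cases j <;> simp <;> fun_prop
  have h3 : Function.LeftInverse (fun e : Fin n → Vec 3 => fun k => (!₂[e k 0, e k 2] : Vec 2))
      planeToSpace := by
    intro e
    funext k
    ext j
    fin_cases j <;> rfl
  exact (h3.isClosedEmbedding h2 h1).measurableEmbedding

/-- A list of edges whose middle coordinates vanish lies in the plane. -/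
theorem exists_planeToSpace_eq {n : ℕ} {e : Fin n → Vec 3} (he : ∀ k, e k 1 = 0) :
    ∃ e' : Fin n → Vec 2, planeToSpace e' = e := by
  refine ⟨fun k => !₂[e k 0, e k 2], ?_⟩
  funext k
  ext j
  fin_cases j
  · rfl
  · exact (he k).symm
  · rfl

/-- The edgelength law of a symmetric measure is the law of `‖q i‖²` under the normalized volume
upstairs. -/
theorem edgelengthLaw_comap_hopfMap {d n : ℕ} {S : Set (Fin n → Vec d)} {ν : Measure (QSpace n)}
    {j : S → Fin n → Vec 3} (hj : MeasurableEmbedding j) (hnorm : ∀ P i, ‖P.1 i‖ = ‖j P i‖)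
    (hν : ∀ᵐ q ∂ν, hopfMap q ∈ range j) (i : Fin n) :
    edgelengthLaw ((ν.map hopfMap).comap j) i = ν.map fun q => ‖q i‖ ^ 2 := by
  have hm : Measurable fun e : Fin n → Vec 3 => ‖e i‖ := by fun_prop
  have hfun : (fun P : S => ‖P.1 i‖) = (fun e : Fin n → Vec 3 => ‖e i‖) ∘ j :=
    funext fun P => hnorm P i
  have hae : ∀ᵐ e ∂ν.map hopfMap, e ∈ range j :=
    (ae_map_iff continuous_hopfMap.measurable.aemeasurable hj.measurableSet_range).2 hν
  -- Pulling back along `j` and pushing forward again restricts to the range of `j`, which loses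
  -- nothing by `hae`.
  rw [edgelengthLaw, hfun, ← Measure.map_map hm hj.measurable, hj.map_comap,
    Measure.restrict_eq_self_of_ae_mem hae, Measure.map_map hm continuous_hopfMap.measurable]
  congr 1
  funext q
  exact norm_hopf _

/-- A function which is invariant under an isometry `e` has the same law under the normalized volume
of `A` and of `A ∪ e '' A`. -/
theorem map_cond_union_image {X Y : Type*} [MetricSpace X] [MeasurableSpace X] [BorelSpace X]
    [MeasurableSpace Y] {m : ℝ} (e : X ≃ᵢ X) {A : Set X} (hA : MeasurableSet A)
    (hd : Disjoint A (e '' A)) {F : X → Y} (hF : Measurable F) (hFe : ∀ x, F (e x) = F x) :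
    (cond (Measure.hausdorffMeasure m) (A ∪ e '' A)).map F =
      (cond (Measure.hausdorffMeasure m) A).map F := by
  set μ : Measure X := Measure.hausdorffMeasure m
  have heA : MeasurableSet (e '' A) := e.toHomeomorph.measurableEmbedding.measurableSet_image.2 hA
  have hμ : μ (A ∪ e '' A) = 2 * μ A := by
    rw [measure_union hd heA, e.hausdorffMeasure_image, two_mul]
  have hr : (μ.restrict (e '' A)).map F = (μ.restrict A).map F := by
    have h := Measure.restrict_map (μ := μ) e.continuous.measurable heA
    rw [e.map_hausdorffMeasure, preimage_image_eq _ e.injective] at h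
    rw [h, Measure.map_map hF e.continuous.measurable]
    congr 1
    exact funext hFe
  rw [ProbabilityTheory.cond, ProbabilityTheory.cond, Measure.map_smul, Measure.map_smul, hμ,
    Measure.restrict_union hd heA, Measure.map_add _ _ hF, hr, ← two_smul ℝ≥0∞, smul_smul,
    ENNReal.mul_inv (Or.inl two_ne_zero) (Or.inl ENNReal.ofNat_ne_top), mul_right_comm,
    ENNReal.inv_mul_cancel two_ne_zero ENNReal.ofNat_ne_top, one_mul]

end Transfer

/-! ### Densities of scaled beta distributions. -/

section BetaDensity

open Set

theorem beta_one_left {b : ℝ} (hb : 0 < b) : beta 1 b = 1 / b := by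
  rw [beta, Real.Gamma_one, add_comm, Real.Gamma_add_one hb.ne']
  have := Real.Gamma_pos_of_pos hb
  field_simp

theorem beta_two_left {b : ℝ} (hb : 0 < b) : beta 2 b = 1 / (b * (b + 1)) := by
  rw [beta, Real.Gamma_two, show 2 + b = b + 1 + 1 by ring,
    Real.Gamma_add_one (by positivity), Real.Gamma_add_one hb.ne']
  have := Real.Gamma_pos_of_pos hb
  field_simp

/-- The density of a scaled beta distribution. -/
theorem densityOn_eq_betaOn {L a b : ℝ} (hL : 0 < L) {φ : ℝ → ℝ} (hφm : Measurable φ)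
    (hφ : ∀ y ∈ Ioo 0 L,
      φ y = L⁻¹ * (1 / beta a b * (y / L) ^ (a - 1) * (1 - y / L) ^ (b - 1))) :
    densityOn L φ = betaOn L a b := by
  have hmb : Measurable (betaPDF a b) := (measurable_betaPDFReal a b).ennreal_ofReal
  refine Measure.ext_of_lintegral _ fun F hF => ?_
  rw [densityOn, betaOn, betaMeasure, lintegral_map hF (by fun_prop),
    lintegral_withDensity_eq_lintegral_mul _ (by fun_prop) hF,
    lintegral_withDensity_eq_lintegral_mul _ hmb (by fun_prop),
    setLIntegral_congr Ioo_ae_eq_Icc.symm]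
  -- The substitution y = Lx produces the factor L⁻¹. The endpoints of [0, L] were discarded as a
  -- null set, so the density formula is needed only inside.
  have hcv : ∫⁻ x, (betaPDF a b * fun x => F (L * x)) x =
      ∫⁻ y, ENNReal.ofReal L⁻¹ * (betaPDF a b (y / L) * F y) := by
    have h := lintegral_map (μ := volume) (f := fun y => betaPDF a b (y / L) * F y)
      (g := fun x => L * x) (by fun_prop) (by fun_prop)
    rw [Real.map_volume_mul_left hL.ne', lintegral_smul_measure, abs_of_pos (by positivity)] at h
    rw [lintegral_const_mul' _ _ ENNReal.ofReal_ne_top]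
    refine Eq.trans ?_ h.symm
    refine lintegral_congr fun x => ?_
    simp only [Pi.mul_apply]
    rw [mul_div_cancel_left₀ _ hL.ne']
  rw [hcv, ← lintegral_indicator measurableSet_Ioo]
  refine lintegral_congr fun y => ?_
  by_cases hy : y ∈ Ioo 0 L
  · rw [indicator_of_mem hy, betaPDF_of_pos_lt_one (div_pos hy.1 hL) ((div_lt_one hL).2 hy.2),
      ← mul_assoc, ← ENNReal.ofReal_mul (by positivity), ← hφ y hy]
    rfl
  · have : ¬(0 < y / L ∧ y / L < 1) := fun h =>
      hy ⟨by simpa [hL] using (div_pos_iff_of_pos_right hL).1 h.1, (div_lt_one hL).1 h.2⟩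
    rw [indicator_of_notMem hy, betaPDF_eq, if_neg this]
    simp

end BetaDensity

/-! ### Edgelengths of arms. -/

section Arms

open Set Module

theorem measurableEmbedding_planeToSpace_subtype {n : ℕ} {S : Set (Fin n → Vec 2)}
    (hS : MeasurableSet S) : MeasurableEmbedding fun P : S => planeToSpace P.1 :=
  measurableEmbedding_planeToSpace.comp (MeasurableEmbedding.subtype_coe hS)

/-- One of n quaternionic coordinates, of real dimension 4, on a sphere with R² = 2: the parameters
are 4/2 and 4(n - 1)/2. -/
theorem edgelengthLaw_symmArm₃ {n : ℕ} (hn : 2 ≤ n) (i : Fin n) :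
    edgelengthLaw (symmArm₃ n) i = betaOn 2 2 (2 * n - 2) := by
  have hmeas : MeasurableSet (spaceSphere n) := Metric.isClosed_sphere.measurableSet
  rw [symmArm₃, edgelengthLaw_comap_hopfMap
    (MeasurableEmbedding.subtype_coe (measurableSet_arm 3 n)) (fun _ _ => rfl)]
  · have hc : ({i} : Finset (Fin n))ᶜ.card = n - 1 := by
      rw [Finset.card_compl, Finset.card_singleton, Fintype.card_fin]
    have h := map_sum_norm_sq_cond_sphere (H := ℍ[ℝ]) (s := {i}) (R := √2) (m := 4 * n - 1)
      (Finset.singleton_nonempty i) (by rw [← Finset.card_pos, hc]; omega) (by positivity)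
      (by rw [Quaternion.finrank_eq_four, Fintype.card_fin]; push_cast; ring)
    simp only [Finset.sum_singleton] at h
    rw [normalizedVolume, spaceSphere, h, hc, Quaternion.finrank_eq_four,
      Real.sq_sqrt zero_le_two, Finset.card_singleton, Nat.cast_sub (by omega)]
    congr 1 <;> push_cast <;> ring
  · refine (ae_cond_mem hmeas).mono fun q hq => ?_
    rw [Subtype.range_val]
    change ∑ k, ‖hopfMap q k‖ = 2
    rw [sum_norm_hopfMap, mem_sphere_zero_iff_norm.1 hq, Real.sq_sqrt zero_le_two]

/-- The subspace `(1 ⊕ 𝐣)ⁿ` of `ℍⁿ`. -/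
def realPlane (n : ℕ) : Set (QSpace n) := {q | ∀ k, (q k).imI = 0 ∧ (q k).imK = 0}

theorem hopfMap_one_of_mem_realPlane {n : ℕ} {q : QSpace n} (hq : q ∈ realPlane n) (k : Fin n) :
    hopfMap q k 1 = 0 := by
  rw [hopfMap, hopf_one, (hq k).1, (hq k).2]
  ring

/-- Multiplication by 𝐢 maps (1 ⊕ 𝐣)ⁿ to (𝐢 ⊕ 𝐤)ⁿ, and these subspaces meet only in 0. -/
theorem disjoint_qiMul_image {n : ℕ} {A : Set (QSpace n)} (hA : A ⊆ realPlane n)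
    (hA0 : (0 : QSpace n) ∉ A) : Disjoint A (qiMul n '' A) := by
  rw [Set.disjoint_left]
  rintro q hq ⟨q', hq', rfl⟩
  refine hA0 ?_
  suffices h : q' = 0 by rwa [h] at hq'
  ext k : 1
  have h1 := hA hq k
  have h2 := hA hq' k
  rw [qiMul_apply] at h1
  ext
  · simpa [qi_re, qi_imI, qi_imJ, qi_imK] using h1.1
  · exact h2.1
  · simpa [qi_re, qi_imI, qi_imJ, qi_imK] using h1.2
  · exact h2.2

/-- The edgelength law on a space of plane polygons whose symmetric measure is obtained from
`A ⊔ 𝐢 A`, with `A` in `(1 ⊕ 𝐣)ⁿ`. -/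
theorem edgelengthLaw_comap_planeToSpace {n : ℕ} {m : ℝ} {S : Set (Fin n → Vec 2)}
    (hS : MeasurableSet S) {A : Set (QSpace n)} (hA : MeasurableSet A) (hAp : A ⊆ realPlane n)
    (hA0 : (0 : QSpace n) ∉ A) (hAS : ∀ q ∈ A, ∀ e, planeToSpace e = hopfMap q → e ∈ S)
    (i : Fin n) :
    edgelengthLaw (((normalizedVolume m (A ∪ qiMul n '' A)).map hopfMap).comap
      fun P : S => planeToSpace P.1) i = (normalizedVolume m A).map fun q => ‖q i‖ ^ 2 := by
  rw [normalizedVolume, map_cond_union_image (qiMul n) hA (disjoint_qiMul_image hAp hA0)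
    continuous_hopfMap.measurable hopfMap_qiMul, edgelengthLaw_comap_hopfMap
    (measurableEmbedding_planeToSpace_subtype hS) fun P i => (norm_planeToSpace _ _).symm]
  · rfl
  · refine (ae_cond_mem hA).mono fun q hq => ?_
    obtain ⟨e, he⟩ := exists_planeToSpace_eq (hopfMap_one_of_mem_realPlane (hAp hq))
    exact ⟨⟨e, hAS q hq e he⟩, he⟩

/-- The isometric embedding of `ℂⁿ` onto `(1 ⊕ 𝐣)ⁿ`. -/
noncomputable def complexToPlane {n : ℕ} (z : PiLp 2 fun _ : Fin n => ℂ) : QSpace n :=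
  WithLp.toLp 2 fun k => ⟨(z k).re, 0, (z k).im, 0⟩

theorem complexToPlane_re {n : ℕ} (z : PiLp 2 fun _ : Fin n => ℂ) (k : Fin n) :
    (complexToPlane z k).re = (z k).re := rfl

theorem complexToPlane_imI {n : ℕ} (z : PiLp 2 fun _ : Fin n => ℂ) (k : Fin n) :
    (complexToPlane z k).imI = 0 := rfl

theorem complexToPlane_imJ {n : ℕ} (z : PiLp 2 fun _ : Fin n => ℂ) (k : Fin n) :
    (complexToPlane z k).imJ = (z k).im := rfl

theorem complexToPlane_imK {n : ℕ} (z : PiLp 2 fun _ : Fin n => ℂ) (k : Fin n) :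
    (complexToPlane z k).imK = 0 := rfl

theorem norm_complexToPlane_apply {n : ℕ} (z : PiLp 2 fun _ : Fin n => ℂ) (k : Fin n) :
    ‖complexToPlane z k‖ ^ 2 = ‖z k‖ ^ 2 := by
  rw [norm_sq_quaternion, ← Complex.normSq_eq_norm_sq, Complex.normSq_apply]
  simp [complexToPlane]
  ring

theorem norm_complexToPlane {n : ℕ} (z : PiLp 2 fun _ : Fin n => ℂ) :
    ‖complexToPlane z‖ = ‖z‖ := by
  refine (sq_eq_sq₀ (norm_nonneg _) (norm_nonneg _)).1 ?_
  rw [PiLp.norm_sq_eq_of_L2, PiLp.norm_sq_eq_of_L2]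
  exact Finset.sum_congr rfl fun k _ => norm_complexToPlane_apply z k

theorem isometry_complexToPlane {n : ℕ} : Isometry (complexToPlane (n := n)) := by
  refine AddMonoidHomClass.isometry_of_norm (AddMonoidHom.mk' (complexToPlane (n := n)) ?_)
    norm_complexToPlane
  intro x y
  ext k : 1
  ext <;> simp [complexToPlane_re, complexToPlane_imI, complexToPlane_imJ, complexToPlane_imK]

/-- This is the form `A` ∪ 𝐢`A` required by `edgelengthLaw_comap_planeToSpace`, with `A` an
isometric copy of a sphere in ℂⁿ. -/
theorem planeSpheres_eq (n : ℕ) : planeSpheres n =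
    complexToPlane '' Metric.sphere 0 (√2) ∪
      qiMul n '' (complexToPlane '' Metric.sphere 0 (√2)) := by
  have h1 : {q : QSpace n | q ∈ Metric.sphere 0 (√2) ∧ ∀ k, (q k).imI = 0 ∧ (q k).imK = 0} =
      complexToPlane '' Metric.sphere 0 (√2) := by
    ext q
    constructor
    · rintro ⟨hq, hk⟩
      have h : complexToPlane (WithLp.toLp 2 fun k => ⟨(q k).re, (q k).imJ⟩) = q := by
        ext k : 1
        ext
        · rfl
        · exact (hk k).1.symm
        · rfl
        · exact (hk k).2.symm
      refine ⟨_, ?_, h⟩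
      rw [mem_sphere_zero_iff_norm, ← norm_complexToPlane, h]
      exact mem_sphere_zero_iff_norm.1 hq
    · rintro ⟨z, hz, rfl⟩
      refine ⟨?_, fun k => ⟨rfl, rfl⟩⟩
      rw [mem_sphere_zero_iff_norm, norm_complexToPlane]
      exact mem_sphere_zero_iff_norm.1 hz
  have hnorm : ∀ q : QSpace n, ‖qiMul n q‖ = ‖q‖ := fun q => by
    refine (sq_eq_sq₀ (norm_nonneg _) (norm_nonneg _)).1 ?_
    rw [← sum_norm_hopfMap, hopfMap_qiMul, sum_norm_hopfMap]
  have h2 : {q : QSpace n | q ∈ Metric.sphere 0 (√2) ∧ ∀ k, (q k).re = 0 ∧ (q k).imJ = 0} =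
      qiMul n '' {q | q ∈ Metric.sphere 0 (√2) ∧ ∀ k, (q k).imI = 0 ∧ (q k).imK = 0} := by
    ext q
    constructor
    · rintro ⟨hq, hk⟩
      have h : qiMul n (qiMul n (-q)) = q := by
        rw [qiMul_apply, qiMul_apply]
        ext k : 1
        change qi * (qi * -q k) = q k
        rw [← mul_assoc, qi_mul_qi]
        simp
      refine ⟨qiMul n (-q), ⟨?_, fun k => ?_⟩, h⟩
      · rw [mem_sphere_zero_iff_norm, hnorm, norm_neg]
        exact mem_sphere_zero_iff_norm.1 hq
      · rw [qiMul_apply]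
        simp [qi_re, qi_imI, qi_imJ, qi_imK, hk k]
    · rintro ⟨q, ⟨hq, hk⟩, rfl⟩
      refine ⟨?_, fun k => ?_⟩
      · rw [mem_sphere_zero_iff_norm, hnorm]
        exact mem_sphere_zero_iff_norm.1 hq
      · rw [qiMul_apply]
        simp [qi_re, qi_imI, qi_imJ, qi_imK, hk k]
  rw [planeSpheres, h2, h1]

/-- The coordinates are now complex, so the parameters are 2/2 and 2(n - 1)/2. -/
theorem edgelengthLaw_symmArm₂ {n : ℕ} (hn : 2 ≤ n) (i : Fin n) :
    edgelengthLaw (symmArm₂ n) i = betaOn 2 1 (n - 1) := by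
  have hmeas : MeasurableSet (Metric.sphere (0 : PiLp 2 fun _ : Fin n => ℂ) (√2)) :=
    Metric.isClosed_sphere.measurableSet
  have hn' : (2 : ℝ) ≤ n := by exact_mod_cast hn
  have hn2 : ∀ q ∈ complexToPlane '' Metric.sphere (0 : PiLp 2 fun _ : Fin n => ℂ) (√2),
      ‖q‖ ^ 2 = 2 := by
    rintro _ ⟨z, hz, rfl⟩
    rw [norm_complexToPlane, mem_sphere_zero_iff_norm.1 hz, Real.sq_sqrt zero_le_two]
  rw [symmArm₂, planeSpheres_eq, edgelengthLaw_comap_planeToSpace (measurableSet_arm 2 n)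
    (isometry_complexToPlane.isClosedEmbedding.measurableEmbedding.measurableSet_image.2 hmeas),
    normalizedVolume, cond_hausdorffMeasure_image (by linarith) isometry_complexToPlane hmeas,
    Measure.map_map (by fun_prop) isometry_complexToPlane.continuous.measurable]
  · have hc : ({i} : Finset (Fin n))ᶜ.card = n - 1 := by
      rw [Finset.card_compl, Finset.card_singleton, Fintype.card_fin]
    have h := map_sum_norm_sq_cond_sphere (H := ℂ) (s := {i}) (R := √2) (m := 2 * n - 1)
      (Finset.singleton_nonempty i) (by rw [← Finset.card_pos, hc]; omega) (by positivity)
      (by rw [Complex.finrank_real_complex, Fintype.card_fin]; push_cast; ring)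
    simp only [Finset.sum_singleton] at h
    have hfun : (fun q : QSpace n => ‖q i‖ ^ 2) ∘ complexToPlane = fun z => ‖z i‖ ^ 2 :=
      funext fun z => norm_complexToPlane_apply z i
    rw [hfun, h, hc, Complex.finrank_real_complex, Real.sq_sqrt zero_le_two,
      Finset.card_singleton, Nat.cast_sub (by omega)]
    congr 1 <;> push_cast <;> ring
  · rintro _ ⟨z, _, rfl⟩ k
    exact ⟨rfl, rfl⟩
  · intro h
    simpa using hn2 0 h
  · intro q hq e he
    change ∑ k, ‖e k‖ = 2
    rw [← hn2 q hq, ← sum_norm_hopfMap, ← he]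
    exact Finset.sum_congr rfl fun k _ => (norm_planeToSpace e k).symm

end Arms

/-! ### Edgelengths of closed polygons. -/

section Polygons

open Set Module

theorem qj_re : qj.re = 0 := rfl

theorem qj_imI : qj.imI = 0 := rfl

theorem qj_imJ : qj.imJ = 1 := rfl

theorem qj_imK : qj.imK = 0 := rfl

section Pairs

variable {n : ℕ}

theorem complexPair_re (p : EuclideanSpace ℂ (Fin n) × EuclideanSpace ℂ (Fin n)) (k : Fin n) :
    (complexPair p k).re = (p.1 k).re := by
  simp [complexPair, qj_re, qj_imI, qj_imJ, qj_imK]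

theorem complexPair_imI (p : EuclideanSpace ℂ (Fin n) × EuclideanSpace ℂ (Fin n)) (k : Fin n) :
    (complexPair p k).imI = (p.1 k).im := by
  simp [complexPair, qj_re, qj_imI, qj_imJ, qj_imK]

theorem complexPair_imJ (p : EuclideanSpace ℂ (Fin n) × EuclideanSpace ℂ (Fin n)) (k : Fin n) :
    (complexPair p k).imJ = (p.2 k).re := by
  simp [complexPair, qj_re, qj_imI, qj_imJ, qj_imK]

theorem complexPair_imK (p : EuclideanSpace ℂ (Fin n) × EuclideanSpace ℂ (Fin n)) (k : Fin n) :
    (complexPair p k).imK = (p.2 k).im := by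
  simp [complexPair, qj_re, qj_imI, qj_imJ, qj_imK]

theorem realPair_re (p : EuclideanSpace ℝ (Fin n) × EuclideanSpace ℝ (Fin n)) (k : Fin n) :
    (realPair p k).re = p.1 k := by
  simp [realPair, qj_re, qj_imI, qj_imJ, qj_imK]

theorem realPair_imI (p : EuclideanSpace ℝ (Fin n) × EuclideanSpace ℝ (Fin n)) (k : Fin n) :
    (realPair p k).imI = 0 := by
  simp [realPair, qj_re, qj_imI, qj_imJ, qj_imK]

theorem realPair_imJ (p : EuclideanSpace ℝ (Fin n) × EuclideanSpace ℝ (Fin n)) (k : Fin n) :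
    (realPair p k).imJ = p.2 k := by
  simp [realPair, qj_re, qj_imI, qj_imJ, qj_imK]

theorem realPair_imK (p : EuclideanSpace ℝ (Fin n) × EuclideanSpace ℝ (Fin n)) (k : Fin n) :
    (realPair p k).imK = 0 := by
  simp [realPair, qj_re, qj_imI, qj_imJ, qj_imK]

/-- A map to `ℍⁿ` is norm preserving if the squared norm of each coordinate of the image is the sum
of the squared norms of the corresponding coordinates. -/
theorem norm_eq_of_norm_sq_apply_eq {𝕜 : Type*} [RCLike 𝕜]
    {Ψ : (PiLp 2 fun _ : Fin 2 => EuclideanSpace 𝕜 (Fin n)) → QSpace n}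
    (h : ∀ p k, ‖Ψ p k‖ ^ 2 = ‖p 0 k‖ ^ 2 + ‖p 1 k‖ ^ 2)
    (p : PiLp 2 fun _ : Fin 2 => EuclideanSpace 𝕜 (Fin n)) : ‖Ψ p‖ = ‖p‖ := by
  refine (sq_eq_sq₀ (norm_nonneg _) (norm_nonneg _)).1 ?_
  rw [PiLp.norm_sq_eq_of_L2, PiLp.norm_sq_eq_of_L2, Fin.sum_univ_two, EuclideanSpace.norm_sq_eq,
    EuclideanSpace.norm_sq_eq, ← Finset.sum_add_distrib]
  exact Finset.sum_congr rfl fun k _ => h p k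

theorem norm_complexPair_apply (p : PiLp 2 fun _ : Fin 2 => EuclideanSpace ℂ (Fin n)) (k : Fin n) :
    ‖complexPair (p 0, p 1) k‖ ^ 2 = ‖p 0 k‖ ^ 2 + ‖p 1 k‖ ^ 2 := by
  rw [norm_sq_quaternion, complexPair_re, complexPair_imI, complexPair_imJ, complexPair_imK,
    ← Complex.normSq_eq_norm_sq, ← Complex.normSq_eq_norm_sq, Complex.normSq_apply,
    Complex.normSq_apply]
  ring

theorem norm_realPair_apply (p : PiLp 2 fun _ : Fin 2 => EuclideanSpace ℝ (Fin n)) (k : Fin n) :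
    ‖realPair (p 0, p 1) k‖ ^ 2 = ‖p 0 k‖ ^ 2 + ‖p 1 k‖ ^ 2 := by
  rw [norm_sq_quaternion, realPair_re, realPair_imI, realPair_imJ, realPair_imK,
    Real.norm_eq_abs, Real.norm_eq_abs, sq_abs, sq_abs]
  ring

theorem isometry_complexPair :
    Isometry fun p : PiLp 2 fun _ : Fin 2 => EuclideanSpace ℂ (Fin n) =>
      complexPair (p 0, p 1) := by
  refine AddMonoidHomClass.isometry_of_norm (AddMonoidHom.mk' _ fun x y => ?_)
    (norm_eq_of_norm_sq_apply_eq norm_complexPair_apply)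
  ext k : 1
  ext <;> simp [qj_re, qj_imI, qj_imJ, qj_imK]

theorem isometry_realPair :
    Isometry fun p : PiLp 2 fun _ : Fin 2 => EuclideanSpace ℝ (Fin n) => realPair (p 0, p 1) := by
  refine AddMonoidHomClass.isometry_of_norm (AddMonoidHom.mk' _ fun x y => ?_)
    (norm_eq_of_norm_sq_apply_eq norm_realPair_apply)
  ext k : 1
  ext <;> simp [qj_re, qj_imI, qj_imJ, qj_imK]

/-- The plain product in `stiefel` carries the sup metric; reparametrizing by the ℓ² product makes
the embeddings into ℍⁿ isometries. -/
theorem image_stiefel_eq {𝕜 : Type} [RCLike 𝕜] {Y : Type*}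
    (F : EuclideanSpace 𝕜 (Fin n) × EuclideanSpace 𝕜 (Fin n) → Y) :
    F '' stiefel 𝕜 n = (fun p : PiLp 2 fun _ : Fin 2 => EuclideanSpace 𝕜 (Fin n) =>
      F (p 0, p 1)) '' orthonormalPairs 𝕜 (EuclideanSpace 𝕜 (Fin n)) := by
  ext q
  constructor
  · rintro ⟨⟨u, v⟩, huv, rfl⟩
    exact ⟨WithLp.toLp 2 ![u, v], huv, rfl⟩
  · rintro ⟨p, hp, rfl⟩
    refine ⟨(p 0, p 1), ?_, rfl⟩
    have h : (fun k => p k) = ![p 0, p 1] := by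
      funext k
      fin_cases k <;> rfl
    have hp : Orthonormal 𝕜 fun k => p k := hp
    rwa [h] at hp

theorem norm_sq_of_mem_orthonormalPairs {𝕜 E : Type*} [RCLike 𝕜] [NormedAddCommGroup E]
    [InnerProductSpace 𝕜 E] {p : PiLp 2 fun _ : Fin 2 => E} (hp : p ∈ orthonormalPairs 𝕜 E) :
    ‖p‖ ^ 2 = 2 := by
  have hp : Orthonormal 𝕜 fun k => p k := hp
  rw [PiLp.norm_sq_eq_of_L2]
  simp [show ∀ k, ‖p k‖ = 1 from hp.1]

/-- For u + v𝐣 the coordinates of the sum are ‖u‖² - ‖v‖², -2 Im⟪u, v⟫ and 2 Re⟪u, v⟫, so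
orthonormality closes the polygon. -/
theorem sum_hopfMap_complexPair {p : PiLp 2 fun _ : Fin 2 => EuclideanSpace ℂ (Fin n)}
    (hp : p ∈ orthonormalPairs ℂ (EuclideanSpace ℂ (Fin n))) :
    ∑ k, hopfMap (complexPair (p 0, p 1)) k = 0 := by
  obtain ⟨h0, h1, h01⟩ := mem_orthonormalPairs.1 hp
  rw [PiLp.inner_apply] at h0 h1 h01
  have hre := congrArg Complex.re h01
  have him := congrArg Complex.im h01
  simp only [RCLike.inner_apply, Complex.re_sum, Complex.im_sum, Complex.mul_re, Complex.mul_im,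
    Complex.conj_re, Complex.conj_im, RCLike.re_to_complex, Complex.zero_re,
    Complex.zero_im] at h0 h1 hre him
  ext j
  simp only [hopfMap, WithLp.ofLp_sum, Finset.sum_apply, PiLp.zero_apply]
  fin_cases j
  · simp only [Fin.zero_eta, hopf_zero, complexPair_re, complexPair_imI, complexPair_imJ,
      complexPair_imK]
    rw [← sub_eq_zero.2 (h0.trans h1.symm), ← Finset.sum_sub_distrib]
    exact Finset.sum_congr rfl fun k _ => by ring
  · simp only [Fin.mk_one, hopf_one, complexPair_re, complexPair_imI, complexPair_imJ,
      complexPair_imK]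
    rw [← mul_zero (-2 : ℝ), ← him, Finset.mul_sum]
    exact Finset.sum_congr rfl fun k _ => by ring
  · simp only [Fin.reduceFinMk, hopf_two, complexPair_re, complexPair_imI, complexPair_imJ,
      complexPair_imK]
    rw [← mul_zero (2 : ℝ), ← hre, Finset.mul_sum]
    exact Finset.sum_congr rfl fun k _ => by ring

theorem sum_hopfMap_realPair {p : PiLp 2 fun _ : Fin 2 => EuclideanSpace ℝ (Fin n)}
    (hp : p ∈ orthonormalPairs ℝ (EuclideanSpace ℝ (Fin n))) :
    ∑ k, hopfMap (realPair (p 0, p 1)) k = 0 := by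
  obtain ⟨h0, h1, h01⟩ := mem_orthonormalPairs.1 hp
  rw [PiLp.inner_apply] at h0 h1 h01
  simp only [RCLike.inner_apply, conj_trivial, RCLike.re_to_real] at h0 h1 h01
  ext j
  simp only [hopfMap, WithLp.ofLp_sum, Finset.sum_apply, PiLp.zero_apply]
  fin_cases j
  · simp only [Fin.zero_eta, hopf_zero, realPair_re, realPair_imI, realPair_imJ, realPair_imK]
    rw [← sub_eq_zero.2 (h0.trans h1.symm), ← Finset.sum_sub_distrib]
    exact Finset.sum_congr rfl fun k _ => by ring
  · simp [hopf_one, realPair_re, realPair_imI, realPair_imJ, realPair_imK]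
  · simp only [Fin.reduceFinMk, hopf_two, realPair_re, realPair_imI, realPair_imJ, realPair_imK]
    simp only [mul_zero, add_zero]
    rw [← mul_zero (2 : ℝ), ← h01, Finset.mul_sum]
    exact Finset.sum_congr rfl fun k _ => by ring

end Pairs

/-- Two of n complex coordinates of a unit vector: the parameters are 2·2/2 and 2(n - 2)/2. -/
theorem edgelengthLaw_symmPol₃ {n : ℕ} (hn : 3 ≤ n) (i : Fin n) :
    edgelengthLaw (symmPol₃ n) i = betaOn 1 2 (n - 2) := by
  have hn' : (3 : ℝ) ≤ n := by exact_mod_cast hn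
  have hmeas : MeasurableSet (orthonormalPairs ℂ (EuclideanSpace ℂ (Fin n))) :=
    measurableSet_orthonormalPairs
  have hΨ := isometry_complexPair (n := n)
  have hA : complexStiefel n = _ := image_stiefel_eq complexPair
  have hmA : MeasurableSet (complexStiefel n) := by
    rw [hA]
    exact hΨ.isClosedEmbedding.measurableEmbedding.measurableSet_image.2 hmeas
  rw [symmPol₃, edgelengthLaw_comap_hopfMap
    (MeasurableEmbedding.subtype_coe (measurableSet_pol 3 n)) (fun _ _ => rfl)]
  · rw [normalizedVolume, hA, cond_hausdorffMeasure_image (by linarith) hΨ hmeas,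
      Measure.map_map (by fun_prop) hΨ.continuous.measurable]
    have hfun : (fun q : QSpace n => ‖q i‖ ^ 2) ∘
        (fun p : PiLp 2 fun _ : Fin 2 => EuclideanSpace ℂ (Fin n) => complexPair (p 0, p 1)) =
        fun p => ‖p 0 i‖ ^ 2 + ‖p 1 i‖ ^ 2 := funext fun p => norm_complexPair_apply p i
    rw [hfun]
    refine (map_sum_norm_sq_cond_orthonormalPairs hn i ?_).trans ?_
    · rw [Complex.finrank_real_complex]
      push_cast
      ring
    · rw [Complex.finrank_real_complex]
      congr 1
      push_cast
      ring
  · refine (ae_cond_mem hmA).mono fun q hq => ?_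
    rw [hA] at hq
    obtain ⟨p, hp, rfl⟩ := hq
    rw [Subtype.range_val]
    refine ⟨?_, sum_hopfMap_complexPair hp⟩
    rw [sum_norm_hopfMap, norm_eq_of_norm_sq_apply_eq norm_complexPair_apply,
      norm_sq_of_mem_orthonormalPairs hp]

/-- Two of n real coordinates of a unit vector: the parameters are 2/2 and (n - 2)/2. -/
theorem edgelengthLaw_symmPol₂ {n : ℕ} (hn : 3 ≤ n) (i : Fin n) :
    edgelengthLaw (symmPol₂ n) i = betaOn 1 1 (n / 2 - 1) := by
  have hn' : (3 : ℝ) ≤ n := by exact_mod_cast hn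
  have hmeas : MeasurableSet (orthonormalPairs ℝ (EuclideanSpace ℝ (Fin n))) :=
    measurableSet_orthonormalPairs
  have hΨ := isometry_realPair (n := n)
  have hA : realStiefel n = _ := image_stiefel_eq realPair
  have hmA : MeasurableSet (realStiefel n) := by
    rw [hA]
    exact hΨ.isClosedEmbedding.measurableEmbedding.measurableSet_image.2 hmeas
  have hn2 : ∀ q ∈ realStiefel n, ‖q‖ ^ 2 = 2 := by
    rw [hA]
    rintro _ ⟨p, hp, rfl⟩
    rw [norm_eq_of_norm_sq_apply_eq norm_realPair_apply, norm_sq_of_mem_orthonormalPairs hp]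
  have hM : realStiefels n = realStiefel n ∪ qiMul n '' realStiefel n := rfl
  rw [symmPol₂, hM, edgelengthLaw_comap_planeToSpace (measurableSet_pol 2 n) hmA]
  · rw [normalizedVolume, hA, cond_hausdorffMeasure_image (by linarith) hΨ hmeas,
      Measure.map_map (by fun_prop) hΨ.continuous.measurable]
    have hfun : (fun q : QSpace n => ‖q i‖ ^ 2) ∘
        (fun p : PiLp 2 fun _ : Fin 2 => EuclideanSpace ℝ (Fin n) => realPair (p 0, p 1)) =
        fun p => ‖p 0 i‖ ^ 2 + ‖p 1 i‖ ^ 2 := funext fun p => norm_realPair_apply p i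
    rw [hfun]
    refine (map_sum_norm_sq_cond_orthonormalPairs hn i ?_).trans ?_
    · rw [finrank_self]
      push_cast
      ring
    · rw [finrank_self]
      congr 1 <;> push_cast <;> ring
  · rintro _ ⟨p, _, rfl⟩ k
    exact ⟨realPair_imI p k, realPair_imK p k⟩
  · intro h
    simpa using hn2 0 h
  · intro q hq e he
    constructor
    · rw [← hn2 q hq, ← sum_norm_hopfMap, ← he]
      exact Finset.sum_congr rfl fun k _ => (norm_planeToSpace e k).symm
    -- Closure is known in space; the first and third coordinates carry it back to the plane.
    · have h : ∑ k, planeToSpace e k = 0 := by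
        rw [hA] at hq
        obtain ⟨p, hp, rfl⟩ := hq
        rw [he]
        exact sum_hopfMap_realPair hp
      ext j
      fin_cases j
      · simpa [planeToSpace] using congrArg (fun v : Vec 3 => v 0) h
      · simpa [planeToSpace] using congrArg (fun v : Vec 3 => v 2) h

end Polygons

end RandomPolygon

/-! ### The four densities in closed form. -/

theorem proposition9p1 (n : ℕ) (i : Fin n) :
    (2 ≤ n →
      RandomPolygon.edgelengthLaw (RandomPolygon.symmArm₃ n) i =
          RandomPolygon.densityOn 2 (fun y =>
            (2 * n - 2) * (2 * n - 1) / 2 ^ (2 * n - 1) * y * (2 - y) ^ (2 * n - 3)) ∧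
        RandomPolygon.edgelengthLaw (RandomPolygon.symmArm₃ n) i =
          RandomPolygon.betaOn 2 2 (2 * n - 2)) ∧
    (2 ≤ n →
      RandomPolygon.edgelengthLaw (RandomPolygon.symmArm₂ n) i =
          RandomPolygon.densityOn 2 (fun y =>
            (n - 1) / 2 ^ (n - 1) * (2 - y) ^ (n - 2)) ∧
        RandomPolygon.edgelengthLaw (RandomPolygon.symmArm₂ n) i =
          RandomPolygon.betaOn 2 1 (n - 1)) ∧
    (3 ≤ n →
      RandomPolygon.edgelengthLaw (RandomPolygon.symmPol₃ n) i =
          RandomPolygon.densityOn 1 (fun y =>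
            (n - 2) * (n - 1) * y * (1 - y) ^ (n - 3)) ∧
        RandomPolygon.edgelengthLaw (RandomPolygon.symmPol₃ n) i =
          RandomPolygon.betaOn 1 2 (n - 2)) ∧
    (3 ≤ n →
      RandomPolygon.edgelengthLaw (RandomPolygon.symmPol₂ n) i =
          RandomPolygon.densityOn 1 (fun y =>
            (n / 2 - 1) * (1 - y) ^ ((n : ℝ) / 2 - 2)) ∧
        RandomPolygon.edgelengthLaw (RandomPolygon.symmPol₂ n) i =
          RandomPolygon.betaOn 1 1 (n / 2 - 1)) := by
  refine ⟨fun hn => ?_, fun hn => ?_, fun hn => ?_, fun hn => ?_⟩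
  · refine ⟨?_, RandomPolygon.edgelengthLaw_symmArm₃ hn i⟩
    rw [RandomPolygon.edgelengthLaw_symmArm₃ hn i]
    have hn' : (2 : ℝ) ≤ n := by exact_mod_cast hn
    refine (RandomPolygon.densityOn_eq_betaOn two_pos (by fun_prop) fun y hy => ?_).symm
    -- The exponents in the density are truncated natural subtractions; the shift makes them honest
    -- and lets real powers become natural ones.
    obtain ⟨k, rfl⟩ : ∃ k, n = k + 2 := ⟨n - 2, by omega⟩
    rw [RandomPolygon.beta_two_left (by linarith),
      show (2 * ((k + 2 : ℕ) : ℝ) - 2 - 1) = ((2 * k + 1 : ℕ) : ℝ) by push_cast; ring,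
      show (2 - 1 : ℝ) = 1 by norm_num, Real.rpow_one, Real.rpow_natCast,
      show 2 * (k + 2) - 3 = 2 * k + 1 by omega, show 2 * (k + 2) - 1 = 2 * k + 1 + 2 by omega,
      show 1 - y / 2 = (2 - y) / 2 by ring, div_pow, pow_add 2 (2 * k + 1) 2]
    field_simp
    push_cast
    ring
  · refine ⟨?_, RandomPolygon.edgelengthLaw_symmArm₂ hn i⟩
    rw [RandomPolygon.edgelengthLaw_symmArm₂ hn i]
    have hn' : (2 : ℝ) ≤ n := by exact_mod_cast hn
    refine (RandomPolygon.densityOn_eq_betaOn two_pos (by fun_prop) fun y hy => ?_).symm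
    obtain ⟨k, rfl⟩ : ∃ k, n = k + 2 := ⟨n - 2, by omega⟩
    rw [RandomPolygon.beta_one_left (by linarith),
      show (((k + 2 : ℕ) : ℝ) - 1 - 1) = (k : ℝ) by push_cast; ring,
      sub_self, Real.rpow_zero, Real.rpow_natCast,
      show k + 2 - 2 = k by omega, show k + 2 - 1 = k + 1 by omega,
      show 1 - y / 2 = (2 - y) / 2 by ring, div_pow, pow_succ]
    field_simp
  · refine ⟨?_, RandomPolygon.edgelengthLaw_symmPol₃ hn i⟩
    rw [RandomPolygon.edgelengthLaw_symmPol₃ hn i]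
    have hn' : (3 : ℝ) ≤ n := by exact_mod_cast hn
    refine (RandomPolygon.densityOn_eq_betaOn one_pos (by fun_prop) fun y hy => ?_).symm
    obtain ⟨k, rfl⟩ : ∃ k, n = k + 3 := ⟨n - 3, by omega⟩
    rw [RandomPolygon.beta_two_left (by linarith),
      show (((k + 3 : ℕ) : ℝ) - 2 - 1) = (k : ℝ) by push_cast; ring,
      show (2 - 1 : ℝ) = 1 by norm_num, Real.rpow_one, Real.rpow_natCast,
      show k + 3 - 3 = k by omega, div_one, inv_one, one_mul, one_div_one_div]
    ring
  · refine ⟨?_, RandomPolygon.edgelengthLaw_symmPol₂ hn i⟩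
    rw [RandomPolygon.edgelengthLaw_symmPol₂ hn i]
    have hn' : (3 : ℝ) ≤ n := by exact_mod_cast hn
    refine (RandomPolygon.densityOn_eq_betaOn one_pos (by fun_prop) fun y hy => ?_).symm
    -- Here the exponent stays a real power: it is a half-integer for odd n and negative for n = 3.
    rw [RandomPolygon.beta_one_left (by linarith), show (n / 2 - 1 - 1 : ℝ) = n / 2 - 2 by ring,
      sub_self, Real.rpow_zero, div_one, inv_one, one_mul, one_div_one_div, mul_one]
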